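/- **Setting.** Strings are elements of $\{0,1\}^*$, $|p|$ is the length of $p$, and $\log$ is to base two. Let $\mathcal U$ be a reference universal prefix machine: a machine with computable step-by-step operation that takes a program $p$ and an auxiliary input $y$, such that for every $y$ the set of halting programs $\{p : \mathcal U(p,y)\text{ halts}\}$ is prefix-free, and such that for every partial computable $V$ with the same prefix-freeness property there is a constant $c_V$ such that, whenever $V(p,y)=x$, some $q$ with $|q|\le |p|+c_V$ satisfies $\mathcal U(q,y)=x$. Write $\mathcal U(p)=\mathcal U(p,\varepsilon)$, $K(x\mid y)=\min\{|p| : \mathcal U(p,y)=x\}$ and $K(x)=K(x\mid\varepsilon)$. Natural numbers, pairs of natural numbers, and finite sets $S\subseteq\{0,1\}^*$ (as the lexicographically ordered list of their elements) are identified with strings by a fixed computable encoding, so that $K(S)$, $K(S\mid y)$, $K(x\mid S)$, $K(a,b\mid y)$ are defined. A program comes *first* in a set of halting programs if it is the fastest one (fewest steps of $\mathcal U$), ties being broken lexicographically. Let $x^*$ be the first program among the shortest programs $p$ with $\mathcal U(p)=x$. **Minimal partial models.** For a string $x$ let $$h_x(\alpha)=\min\{\lceil\log|S|\rceil : x\in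 S,\ S \text{ finite},\ K(S)\le\alpha\},$$ and let $\alpha_0$ be the least $\alpha$ for which this is defined. The *witness* of $h_x(\alpha)$ is the set $S\ni x$ with $\lceil \log|S|\rceil\le h_x(\alpha)$ that is output by the first program of length $\alpha$ having such an output. Fix a threshold $Q_x(\alpha)=K(h_x(\alpha)\mid\alpha)+e(x,\alpha)$, where $e(x,\alpha)\ge 0$ is any non-negative integer-valued error term (for instance one that is $O(\log\log|x|)$), and fix constants $c,d\in\mathbb N$. For a finite set $S\ni x$, the index model $S[i]$ is the set of $y\in S$ whose index in the lexicographic order of $S$, written with $\lceil\log|S|\rceil$ bits, has the same first $i$ bits as that of $x$; put $S(\gamma)=S[\bar\imath(\gamma)]$, where $\bar\imath(\gamma)=\max\{i : i+K(i)+c\le\gamma\}$ (and $\bar\imath(\gamma)=0$ if there is no such $i$). Define recursively $k_{\alpha_0}=\alpha_0$, $S^{(\alpha_0)}=$ the witness of $h_x(\alpha_0)$, and for $\alpha>\alpha_0$ $$(S^{(\alpha)},k_\alpha)=\begin{cases}(\text{the witness of }h_x(\alpha),\ \alpha) & \text{if } k_{\alpha-1}+h_x(k_{\alpha-1})-\alpha-h_x(\alpha)\ge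 Q_x(k_{\alpha-1}),\\ (S^{(k_{\alpha-1})}(\alpha-k_{\alpha-1}),\ k_{\alpha-1}) & \text{otherwise.}\end{cases}$$ The *minimal partial models* of $x$ are the sets $S^{(k_\alpha)}$ with $\alpha_0\le\alpha\le K(x)+d$. **Theorem.** There is a constant $C$, depending only on $\mathcal U$ (not on $e$, $c$, $d$), such that for every string $x$ and every minimal partial model $S_i$ of $x$ $$\bigl|\,K(S_i\mid x^*)-K\bigl(K(S_i),\lceil\log|S_i|\rceil\mid x^*\bigr)\bigr|\le C,$$ and, if moreover $n=|x|\ge 2$, then $$K(S_i\mid x)\le C\log n,\qquad K\bigl(K(S_i),\lceil\log|S_i|\rceil\mid x^*\bigr)\le C\log n,\qquad \bigl|K(x)-\bigl(K(S_i)+K(x\mid S_i)\bigr)\bigr|\le C\log n .$$ -/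

import Mathlib

namespace AlgStat

/-- A machine with two input tapes, the program and the auxiliary input, given by its computable
transition system. A configuration `s` is halting when `out s = some x`; the output is then `x`. -/
structure Machine where
  Cfg : Type
  [primcodable : Primcodable Cfg]
  init : List Bool → List Bool → Cfg
  step : Cfg → Cfg
  out : Cfg → Option (List Bool)
  init_computable : Computable₂ init
  step_computable : Computable step
  out_computable : Computable out

attribute [instance] Machine.primcodable

/-- The configuration reached after `t` steps on program `p` with auxiliary input `y`. -/
def Machine.conf (U : Machine) (p y : List Bool) (t : ℕ) : U.Cfg :=
  U.step^[t] (U.init p y)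

/-- `U` reaches its first halting configuration after exactly `t` steps, with output `x`. -/
def Machine.HaltsAt (U : Machine) (p y : List Bool) (t : ℕ) (x : List Bool) : Prop :=
  U.out (U.conf p y t) = some x ∧ ∀ s < t, U.out (U.conf p y s) = none

/-- `U (p, y) = x`: the machine halts on `(p, y)` with output `x`. -/
def Machine.Outputs (U : Machine) (p y x : List Bool) : Prop :=
  ∃ t, U.HaltsAt p y t x

/-- The running time of a halting program `p` with auxiliary input `y`. -/
noncomputable def Machine.rt (U : Machine) (p y : List Bool) : ℕ :=
  sInf {t | ∃ x, U.HaltsAt p y t x}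

/-- No element of `P` is a proper prefix of another one. -/
def PrefixFree (P : Set (List Bool)) : Prop :=
  ∀ p ∈ P, ∀ q ∈ P, p <+: q → p = q

/-- A reference universal prefix machine: for each auxiliary input, its halting programs form a
prefix code, and it simulates every other partial computable function with this property at the
price of a constant additive overhead in program length. -/
structure Machine.IsUniversal (U : Machine) : Prop where
  prefixFree : ∀ y, PrefixFree {p | ∃ x, U.Outputs p y x}
  simulates : ∀ V : List Bool → List Bool →. List Bool, Partrec₂ V →
    (∀ y, PrefixFree {p | (V p y).Dom}) →
    ∃ c : ℕ, ∀ p y x, x ∈ V p y → ∃ q, U.Outputs q y x ∧ q.length ≤ p.length + c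

/-- The string that encodes a discrete object: the binary digits of its standard numbering.
In particular the code of a natural number is its binary expansion. -/
def code {α : Type*} [Encodable α] (a : α) : List Bool :=
  (Encodable.encode a).bits

/-- The code `⟨x₁, …, x_N⟩` of the lexicographically ordered list of the elements of `S`. -/
def setCode (S : Finset (List Bool)) : List Bool :=
  code (S.sort (· ≤ ·))

section
variable (U : Machine)

/-- Conditional complexity `K(x | y)`. -/
noncomputable def condK (x y : List Bool) : ℕ :=
  sInf {l | ∃ p, U.Outputs p y x ∧ p.length = l}

/-- Complexity `K(x)`: the auxiliary input is the empty word. -/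
noncomputable def K (x : List Bool) : ℕ := condK U x []

/-- `K(S)` for a finite set `S` of strings. -/
noncomputable def setK (S : Finset (List Bool)) : ℕ := K U (setCode S)

/-- `p` is the first program in `P` to halt (without auxiliary input): the fastest one, and among
programs with the same running time the first in lexicographic order. -/
def IsFirst (P : Set (List Bool)) (p : List Bool) : Prop :=
  p ∈ P ∧ ∀ q ∈ P, U.rt p [] < U.rt q [] ∨ (U.rt p [] = U.rt q [] ∧ p ≤ q)

/-- The program `x*`: the first one to halt among the shortest programs for `x`. -/
noncomputable def star (x : List Bool) : List Bool :=
  Classical.epsilon (IsFirst U {p | U.Outputs p [] x ∧ p.length = K U x})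

/-- `⌈log |S|⌉`, to base two. -/
def logCard (S : Finset (List Bool)) : ℕ := Nat.clog 2 S.card

/-- The structure function `h_x(α)`, which is defined when `α` is at least `minLevel U x`. -/
noncomputable def structureFn (x : List Bool) (α : ℕ) : ℕ :=
  sInf {m | ∃ S : Finset (List Bool), x ∈ S ∧ setK U S ≤ α ∧ logCard S = m}

/-- `α₀`, the smallest `α` for which `h_x(α)` is defined. -/
noncomputable def minLevel (x : List Bool) : ℕ :=
  sInf {α | ∃ S : Finset (List Bool), x ∈ S ∧ setK U S ≤ α}

/-- The program `p` outputs the model `S` of `x`, whose log-cardinality is at most `h_x(α)`. -/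
def OutputsOptimal (x : List Bool) (α : ℕ) (p : List Bool) (S : Finset (List Bool)) : Prop :=
  U.Outputs p [] (setCode S) ∧ x ∈ S ∧ logCard S ≤ structureFn U x α

/-- The witness of `h_x(α)`: the optimal model that is produced by the first program of length `α`
to halt with such an output. -/
noncomputable def witness (x : List Bool) (α : ℕ) : Finset (List Bool) :=
  Classical.epsilon fun S => ∃ p,
    IsFirst U {q | q.length = α ∧ ∃ S', OutputsOptimal U x α q S'} p ∧ OutputsOptimal U x α p S

/-- The index of `y` in `S`, namely its position in lexicographic order, counted from `0`. -/
def index (S : Finset (List Bool)) (y : List Bool) : ℕ := (S.filter (· < y)).card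

/-- The index model `S[i]` of `x`: the elements of `S` whose indices, written with `⌈log |S|⌉` bits,
have the same first `i` bits as the index of `x`. -/
def indexModel (x : List Bool) (S : Finset (List Bool)) (i : ℕ) : Finset (List Bool) :=
  S.filter fun y => index S y / 2 ^ (logCard S - i) = index S x / 2 ^ (logCard S - i)

/-- The largest `i` with `i + K(i) + c ≤ γ` (and `0` if there is none): the number of index bits
that can be specified with `γ` extra bits of model description. -/
noncomputable def indexBits (c γ : ℕ) : ℕ :=
  sSup {i | i + K U (code i) + c ≤ γ}

/-- The threshold `Q(α) = K(h_x(α) | α) + e`. -/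
noncomputable def threshold (e : List Bool → ℕ → ℕ) (x : List Bool) (α : ℕ) : ℕ :=
  condK U (code (structureFn U x α)) (code α) + e x α

open Classical in
/-- `k_α`, the last level `≤ α` at which a drop occurs (equal to `α₀` at `α₀`). There is a drop at
`α + 1` if `k_α + h_x(k_α) - (α + 1) - h_x(α + 1) ≥ Q(k_α)`. -/
noncomputable def dropLevel (e : List Bool → ℕ → ℕ) (x : List Bool) : ℕ → ℕ
  | 0 => minLevel U x
  | α + 1 =>
    let k := dropLevel e x α
    if minLevel U x ≤ α ∧
        (α + 1) + structureFn U x (α + 1) + threshold U e x k ≤ k + structureFn U x k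
    then α + 1 else k

/-- The model `S^(α)`: the witness of `h_x(α)` if a drop occurs at `α` (or `α = α₀`), and otherwise
the index model of `S^(k_α)` that is described with `α - k_α` extra bits. -/
noncomputable def modelAt (e : List Bool → ℕ → ℕ) (c : ℕ) (x : List Bool) (α : ℕ) :
    Finset (List Bool) :=
  let k := dropLevel U e x α
  if k = α then witness U x α else indexModel x (witness U x k) (indexBits U c (α - k))

/-- The minimal partial models of `x`: the models `S^(k_α)` for `α₀ ≤ α ≤ K(x) + d`. -/
def minimalPartialModels (e : List Bool → ℕ → ℕ) (c d : ℕ) (x : List Bool) :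
    Set (Finset (List Bool)) :=
  {S | ∃ α, minLevel U x ≤ α ∧ α ≤ K U x + d ∧ S = modelAt U e c x (dropLevel U e x α)}

end

end AlgStat

/-!
# Complexity of minimal partial models

Let `S` be a minimal partial model of `x`, at the level `k = k_α`.

*Structure.* A level `k_α` is either `α₀` or a level at which `h_x` strictly decreases, because the
threshold is nonnegative. Hence every model of complexity less than `k` has log-cardinality greater
than `h_x(k)`. It follows that the witness at level `k` satisfies `K(S) = k` and
`⌈log |S|⌉ = h_x(k)`, and that a model `T` of `x` with `K(T) < K(S)` has a larger log-cardinality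
than `S` (`minimalPartialModels_spec`). Taking `T = {x}` gives `K(S) ≤ K({x}) = O(|x|)`. Taking for
`T` the set of all strings of length `|x|` shows that `K(S) = O(log |x|)` or `⌈log |S|⌉ ≤ |x|`. In
both cases `K(S | x)` is logarithmic.

*From the pair to the model.* Given `x`, `k` and `h_x(k)`, the programs of length `k` can be run
in the order of their running times until one of them outputs a model of `x` of log-cardinality at
most `h_x(k)`. This is the witness, so that `K(S | x)` and `K(S | x*)` are bounded by the
corresponding complexity of the pair `(K(S), ⌈log |S|⌉)`, up to a constant
(`condK_minimalPartialModel_le`).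

*From the model to the pair.* The log-cardinality can be read off `S`. That `K(S)` too can be
obtained from `S` and `x*` at no cost is a form of symmetry of information, valid for all
strings `y` in place of `S`: `K(⟨K(y), y⟩ | x*) ≤ K(y | x*) + O(1)` (`condK_K_pair_le`). To see
this, enumerate the pairs of programs `(u, q)` with outputs `x = U(u)` and `y = U(q, u)`, with
weight `2 ^ (-|u| - |q|)`. By the coding theorem the pairs with second output `y` have total weight
`O(2 ^ (-K(y)))`. If `s` is a program for `y`, then `s` may be attached to all pairs for `y` that
are enumerated before their total weight exceeds `O(2 ^ (-|s|))`; the resulting triples have total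
weight `O(1)`, and a shortest program for `y` can be attached to every pair for `y`. By the coding
theorem, the triples with first output `x` have total weight `O(2 ^ (-K(x)))`. Given `u = x*`, the
triples that begin with `u` therefore have weights `2 ^ (-|q|)` of bounded sum, and the
Kraft–Chaitin theorem in condition `x*` describes `(|s|, y)` with `|q| + O(1)` bits.

*Two-part description.* The inequality `K(x) ≤ K(S) + K(x | S) + O(1)` is subadditivity. In the
other direction, the same enumeration, used in condition `y = S` with a guess of `K(y)` that
costs `O(log K(y))` bits, gives `K(y) + K(x | y) ≤ K(x) + K(y | x*) + O(log K(y))`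
(`K_add_condK_le`), and `K(S | x*)` is logarithmic.

The coding theorem and the Kraft–Chaitin theorem (`coding_theorem`, `condK_le_of_request`) are
proved for computable families of requests, where a request `(n, x)` asks for a program of length
`n + O(1)` for `x`. Weights are summed in `ℝ≥0∞`, and compared effectively as dyadic fractions.
-/

open scoped ENNReal

namespace AlgStat

/-! ### Primitive recursive operations on strings -/

theorem primrec_pow : Primrec₂ ((· ^ ·) : ℕ → ℕ → ℕ) :=
  Primrec₂.unpaired'.1 Nat.Primrec.pow

theorem primrec_testBit : Primrec₂ Nat.testBit := by
  have h : PrimrecRel fun a i : ℕ => a / 2 ^ i % 2 = 1 :=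
    Primrec.eq.comp₂ (Primrec.nat_mod.comp₂ (Primrec.nat_div.comp₂ Primrec₂.left
      (primrec_pow.comp₂ (Primrec₂.const 2) Primrec₂.right)) (Primrec₂.const 2)) (Primrec₂.const 1)
  exact h.decide.of_eq fun a i => (Nat.testBit_eq_decide_div_mod_eq).symm

/-- The `k` lowest binary digits of `j`, most significant digit first. For `j < 2 ^ k` this is the
`j`-th string of length `k` in lexicographic order. -/
def natString (k j : ℕ) : List Bool :=
  Nat.rec [] (fun i l => j.testBit i :: l) k

theorem natString_zero (j : ℕ) : natString 0 j = [] := rfl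

theorem natString_succ (k j : ℕ) : natString (k + 1) j = j.testBit k :: natString k j := rfl

theorem primrec_natString : Primrec₂ natString :=
  Primrec.nat_rec' (f := fun p : ℕ × ℕ => p.1) (g := fun _ => ([] : List Bool))
    (h := fun p q => p.2.testBit q.1 :: q.2) Primrec.fst (Primrec.const _)
    (Primrec.list_cons.comp
      (primrec_testBit.comp (Primrec.snd.comp Primrec.fst) (Primrec.fst.comp Primrec.snd))
      (Primrec.snd.comp Primrec.snd))

@[simp] theorem length_natString (k j : ℕ) : (natString k j).length = k := by
  induction k with
  | zero => rfl
  | succ k ih => simp [natString_succ, ih]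

theorem natString_congr {k a b : ℕ} (h : ∀ i < k, a.testBit i = b.testBit i) :
    natString k a = natString k b := by
  induction k with
  | zero => rfl
  | succ k ih =>
    rw [natString_succ, natString_succ, h k (by omega), ih fun i hi => h i (by omega)]

theorem testBit_eq_of_natString_eq {k a b : ℕ} (h : natString k a = natString k b) :
    ∀ i < k, a.testBit i = b.testBit i := by
  induction k with
  | zero => simp
  | succ k ih =>
    simp only [natString_succ, List.cons.injEq] at h
    intro i hi
    rcases Nat.lt_succ_iff_lt_or_eq.1 hi with hi | rfl
    · exact ih h.2 i hi
    · exact h.1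

theorem natString_injOn {k a b : ℕ} (ha : a < 2 ^ k) (hb : b < 2 ^ k)
    (h : natString k a = natString k b) : a = b := by
  apply Nat.eq_of_testBit_eq
  intro i
  rcases lt_or_ge i k with hi | hi
  · exact testBit_eq_of_natString_eq h i hi
  · rw [Nat.testBit_lt_two_pow (ha.trans_le (Nat.pow_le_pow_right two_pos hi)),
      Nat.testBit_lt_two_pow (hb.trans_le (Nat.pow_le_pow_right two_pos hi))]

theorem exists_natString_eq (p : List Bool) : ∃ j < 2 ^ p.length, natString p.length j = p := by
  induction p with
  | nil => exact ⟨0, by simp, rfl⟩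
  | cons b p ih =>
    obtain ⟨j, hj, hp⟩ := ih
    refine ⟨2 ^ p.length * b.toNat + j, ?_, ?_⟩
    · rw [List.length_cons, pow_succ]
      cases b <;> simp <;> omega
    · rw [List.length_cons, natString_succ]
      congr 1
      · rw [Nat.testBit_two_pow_mul_add _ hj]
        cases b <;> simp
      · rw [← hp, length_natString]
        apply natString_congr
        intro i hi
        rw [Nat.testBit_two_pow_mul_add _ hj, if_pos hi]

theorem take_natString {n k j : ℕ} (h : n ≤ k) :
    (natString k j).take n = natString n (j / 2 ^ (k - n)) := by
  induction n generalizing k with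
  | zero => simp [natString_zero]
  | succ n ih =>
    obtain ⟨k, rfl⟩ : ∃ k', k = k' + 1 := ⟨k - 1, by omega⟩
    rw [natString_succ, natString_succ, List.take_succ_cons, ih (by omega),
      Nat.testBit_div_two_pow]
    have h1 : k + 1 - (n + 1) = k - n := by omega
    have h2 : n + (k - n) = k := by omega
    rw [h1, h2]

/-- A string of length `n` is a prefix of another one precisely if the dyadic interval that it
names contains the other dyadic interval. -/
theorem div_eq_of_natString_prefix {n k a b : ℕ} (ha : a < 2 ^ n) (hb : b < 2 ^ k)
    (h : natString n a <+: natString k b) : n ≤ k ∧ a = b / 2 ^ (k - n) := by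
  have hle : n ≤ k := by simpa using h.length_le
  refine ⟨hle, natString_injOn ha ?_ ?_⟩
  · rw [Nat.div_lt_iff_lt_mul (by positivity), ← pow_add]
    rwa [show n + (k - n) = k by omega]
  · rw [← take_natString hle]
    simpa using List.prefix_iff_eq_take.1 h

theorem natString_lt {k a b : ℕ} (hab : a < b) (hb : b < 2 ^ k) :
    natString k a < natString k b := by
  induction k generalizing a b with
  | zero => simp at hb; omega
  | succ k ih =>
    rw [natString_succ, natString_succ, List.cons_lt_cons_iff]
    have h2 : 2 ^ (k + 1) = 2 ^ k + 2 ^ k := by rw [pow_succ]; ring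
    rcases lt_or_ge a (2 ^ k) with ha | ha <;> rcases lt_or_ge b (2 ^ k) with hb' | hb'
    · right
      refine ⟨?_, ih hab hb'⟩
      rw [Nat.testBit_lt_two_pow ha, Nat.testBit_lt_two_pow hb']
    · left
      rw [Nat.testBit_lt_two_pow ha, Nat.testBit_of_two_pow_le_and_two_pow_add_one_gt hb' hb]
      decide
    · omega
    · right
      refine ⟨?_, ?_⟩
      · rw [Nat.testBit_of_two_pow_le_and_two_pow_add_one_gt hb' hb,
          Nat.testBit_of_two_pow_le_and_two_pow_add_one_gt ha (hab.trans hb)]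
      · have key : ∀ c, 2 ^ k ≤ c → c < 2 ^ (k + 1) → natString k c = natString k (c - 2 ^ k) := by
          intro c h1 _
          apply natString_congr
          intro i hi
          conv_lhs => rw [show c = 2 ^ k + (c - 2 ^ k) by omega]
          exact Nat.testBit_two_pow_add_gt hi _
        rw [key a ha (hab.trans hb), key b hb' hb]
        exact ih (by omega) (by omega)

/-- The number whose binary digits, least significant first, form the given list. -/
def bitsVal (l : List Bool) : ℕ :=
  l.foldr (fun b n => b.toNat + 2 * n) 0

theorem primrec_bitsVal : Primrec bitsVal := by
  refine Primrec.list_foldr (h := fun (_ : List Bool) (p : Bool × ℕ) => p.1.toNat + 2 * p.2)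
    Primrec.id (Primrec.const 0) ?_
  refine Primrec.nat_add.comp ?_
    (Primrec.nat_mul.comp (Primrec.const 2) (Primrec.snd.comp Primrec.snd))
  exact (Primrec.dom_bool Bool.toNat).comp (Primrec.fst.comp Primrec.snd)

theorem bits_succ (n : ℕ) : (n + 1).bits = decide ((n + 1) % 2 = 1) :: ((n + 1) / 2).bits := by
  rcases Nat.even_or_odd' (n + 1) with ⟨m, hm | hm⟩
  · rw [hm, Nat.bit0_bits m (by omega)]
    simp
  · rw [hm, Nat.bit1_bits m]
    have h1 : (2 * m + 1) % 2 = 1 := by omega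
    have h2 : (2 * m + 1) / 2 = m := by omega
    rw [h1, h2]
    simp

@[simp] theorem bitsVal_bits (n : ℕ) : bitsVal n.bits = n := by
  induction n using Nat.strong_induction_on with
  | _ n ih =>
    cases n with
    | zero => simp [bitsVal]
    | succ n =>
      rw [bits_succ]
      have := ih ((n + 1) / 2) (by omega)
      unfold bitsVal at this ⊢
      rw [List.foldr_cons, this]
      rcases Nat.mod_two_eq_zero_or_one (n + 1) with h | h <;> simp [h] <;> omega

theorem primrec_bits : Primrec Nat.bits := by
  have : Primrec₂ fun (_ : Unit) n => Nat.bits n := by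
    refine Primrec.nat_strong_rec _
      (g := fun _ l => if l.length = 0 then some [] else
        (l[l.length / 2]?).map fun v => decide (l.length % 2 = 1) :: v) ?_ ?_
    · have hl : Primrec fun p : Unit × List (List Bool) => p.2.length :=
        Primrec.list_length.comp Primrec.snd
      refine Primrec.ite (Primrec.eq.comp hl (Primrec.const 0)) (Primrec.const _) ?_
      refine Primrec.option_map (Primrec.list_getElem?.comp Primrec.snd
        (Primrec.nat_div.comp hl (Primrec.const 2))) ?_
      refine Primrec.list_cons.comp ?_ Primrec.snd
      exact (Primrec.eq.comp (Primrec.nat_mod.comp (hl.comp Primrec.fst) (Primrec.const 2))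
        (Primrec.const 1)).decide
    · intro _ n
      cases n with
      | zero => simp
      | succ n =>
        have h : (n + 1) / 2 < n + 1 := by omega
        simp [List.getElem?_range h, bits_succ, -List.map_eq_map]
  exact this.comp (Primrec.const ()) Primrec.id

theorem code_injective {α : Type*} [Encodable α] : Function.Injective (code (α := α)) := by
  intro a b h
  have := congrArg bitsVal h
  simpa [code] using this

theorem primrec_code {α : Type*} [Primcodable α] : Primrec (code (α := α)) :=
  primrec_bits.comp Primrec.encode

/-- The inverse of `code`. -/
def uncode (α : Type*) [Encodable α] (y : List Bool) : Option α :=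
  Encodable.decode (bitsVal y)

theorem primrec_uncode {α : Type*} [Primcodable α] : Primrec (uncode α) :=
  Primrec.decode.comp primrec_bitsVal

@[simp] theorem uncode_code {α : Type*} [Encodable α] (a : α) : uncode α (code a) = some a := by
  simp [uncode, code]

theorem length_code_le {m : ℕ} {k : ℕ} (h : m < 2 ^ k) : (m.bits).length ≤ k := by
  rw [Nat.size_eq_bits_len]
  exact Nat.size_le.2 h

/-- The lexicographic order by bounded quantification over the first position of difference. -/
theorem list_lt_iff_exists (a b : List Bool) : a < b ↔ ∃ i < b.length, a = b.take i ∨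
    (a.take i = b.take i ∧ a[i]? = some false ∧ b[i]? = some true) := by
  induction a generalizing b with
  | nil =>
    cases b with
    | nil => simp
    | cons c b => simp only [List.nil_lt_cons, true_iff]; exact ⟨0, by simp, by simp⟩
  | cons d a ih =>
    cases b with
    | nil => simp
    | cons c b =>
      rw [List.cons_lt_cons_iff, ih]
      constructor
      · rintro (h | ⟨rfl, i, hi, h⟩)
        · refine ⟨0, by simp, Or.inr ?_⟩
          have : d = false ∧ c = true := by revert h; cases c <;> cases d <;> decide
          simp [this]
        · refine ⟨i + 1, by simpa using hi, ?_⟩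
          simpa using h
      · rintro ⟨i, hi, h⟩
        cases i with
        | zero =>
          left
          simp at h
          simp [h]
        | succ i =>
          right
          simp only [List.take_succ_cons, List.cons.injEq, List.getElem?_cons_succ] at h
          refine ⟨?_, i, by simpa using hi, ?_⟩ <;> tauto

theorem primrecRel_list_lt : PrimrecRel ((· < ·) : List Bool → List Bool → Prop) := by
  have h : PrimrecRel fun (i : ℕ) (p : List Bool × List Bool) => p.1 = p.2.take i ∨
      (p.1.take i = p.2.take i ∧ p.1[i]? = some false ∧ p.2[i]? = some true) := by
    have h1 : Primrec fun q : ℕ × (List Bool × List Bool) => q.2.1 := Primrec.fst.comp Primrec.snd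
    have h2 : Primrec fun q : ℕ × (List Bool × List Bool) => q.2.2 := Primrec.snd.comp Primrec.snd
    refine PrimrecPred.or (Primrec.eq.comp h1 (Primrec.list_take.comp Primrec.fst h2)) ?_
    refine PrimrecPred.and (Primrec.eq.comp (Primrec.list_take.comp Primrec.fst h1)
      (Primrec.list_take.comp Primrec.fst h2)) ?_
    exact PrimrecPred.and
      (Primrec.eq.comp (Primrec.list_getElem?.comp h1 Primrec.fst) (Primrec.const _))
      (Primrec.eq.comp (Primrec.list_getElem?.comp h2 Primrec.fst) (Primrec.const _))
  refine (h.exists_mem_list.comp (f := fun q : List Bool × List Bool => List.range q.2.length)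
    (g := fun q => q) (Primrec.list_range.comp (Primrec.list_length.comp Primrec.snd))
    Primrec.id).of_eq ?_
  rintro ⟨a, b⟩
  simp [list_lt_iff_exists]

/-! ### Recognizing the codes of the models of a string -/

/-- The string `y` is the code of a set that contains `x` and whose log-cardinality is at most
`l`. -/
def IsModelCode (x : List Bool) (l : ℕ) (y : List Bool) : Prop :=
  ∃ S : Finset (List Bool), setCode S = y ∧ x ∈ S ∧ logCard S ≤ l

theorem setCode_toFinset {L : List (List Bool)} (hL : L.Pairwise (· < ·)) :
    setCode L.toFinset = code L := by
  have hn : L.Nodup := hL.imp fun h => ne_of_lt h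
  unfold setCode
  rw [(List.toFinset_sort (· ≤ ·) hn).2 (hL.imp le_of_lt)]

/-- The code of a set is recognized by decoding it to a list and testing that the list is strictly
increasing; the condition `y = code L` excludes strings that are decoded but are not codes. -/
theorem isModelCode_iff (x : List Bool) (l : ℕ) (y : List Bool) :
    IsModelCode x l y ↔ ∃ L : List (List Bool), uncode (List (List Bool)) y = some L ∧
      y = code L ∧ x ∈ L ∧ L.length ≤ 2 ^ l ∧
      ∀ i < L.length, ∀ u ∈ L[i]?, ∀ v ∈ L[i + 1]?, u < v := by
  constructor
  · rintro ⟨S, rfl, hx, hl⟩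
    refine ⟨S.sort (· ≤ ·), by simp [setCode], rfl, by simpa using hx, ?_, ?_⟩
    · rw [Finset.length_sort]
      exact (Nat.clog_le_iff_le_pow one_lt_two).1 hl
    · intro i hi u hu v hv
      obtain ⟨h1, rfl⟩ := List.getElem?_eq_some_iff.1 hu
      obtain ⟨h2, rfl⟩ := List.getElem?_eq_some_iff.1 hv
      exact (List.pairwise_iff_getElem.1 (Finset.sortedLT_sort S).pairwise) i (i + 1) h1 h2
        (by omega)
  · rintro ⟨L, -, rfl, hx, hl, hs⟩
    have hL : L.Pairwise (· < ·) := by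
      rw [← List.isChain_iff_pairwise, List.isChain_iff_getElem]
      intro i hi
      exact hs i (by omega) _ (by simp [show i < L.length by omega]) _ (by simp [hi])
    refine ⟨L.toFinset, setCode_toFinset hL, by simpa using hx, ?_⟩
    unfold logCard
    rw [Nat.clog_le_iff_le_pow one_lt_two]
    exact (L.toFinset_card_le).trans hl

theorem primrecPred_isModelCode :
    PrimrecPred fun q : (List Bool × ℕ) × List Bool => IsModelCode q.1.1 q.1.2 q.2 := by
  classical
  -- the conjunction that has to hold for the decoded list
  let P : ((List Bool × ℕ) × List Bool) → List (List Bool) → Prop := fun q L =>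
    q.2 = code L ∧ q.1.1 ∈ L ∧ L.length ≤ 2 ^ q.1.2 ∧
      ∀ i < L.length, ∀ u ∈ L[i]?, ∀ v ∈ L[i + 1]?, u < v
  have hsort : PrimrecPred fun L : List (List Bool) =>
      ∀ i < L.length, ∀ u ∈ L[i]?, ∀ v ∈ L[i + 1]?, u < v := by
    have h1 : Primrec fun p : ℕ × List (List Bool) => p.2[p.1]?.getD [] :=
      Primrec.option_getD.comp (Primrec.list_getElem?.comp Primrec.snd Primrec.fst)
        (Primrec.const _)
    have h2 : Primrec fun p : ℕ × List (List Bool) => p.2[p.1 + 1]?.getD [] :=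
      Primrec.option_getD.comp
        (Primrec.list_getElem?.comp Primrec.snd (Primrec.succ.comp Primrec.fst)) (Primrec.const _)
    have h : PrimrecRel fun (i : ℕ) (L : List (List Bool)) =>
        L.length ≤ i + 1 ∨ L[i]?.getD [] < L[i + 1]?.getD [] :=
      PrimrecPred.or (Primrec.nat_le.comp (Primrec.list_length.comp Primrec.snd)
        (Primrec.succ.comp Primrec.fst)) (primrecRel_list_lt.comp h1 h2)
    refine (h.forall_mem_list.comp (f := fun L : List (List Bool) => List.range L.length)
      (g := fun L => L) (Primrec.list_range.comp Primrec.list_length) Primrec.id).of_eq ?_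
    intro L
    simp only [List.mem_range]
    refine forall₂_congr fun i hi => ?_
    rcases le_or_gt L.length (i + 1) with h | h
    · simp [h]
    · simp [h, hi, not_le.2 h]
  have hmem : PrimrecRel fun (L : List (List Bool)) (x : List Bool) => x ∈ L :=
    (PrimrecRel.exists_mem_list Primrec.eq).of_eq fun L x => by simp
  have hP : PrimrecRel P := by
    refine PrimrecPred.and (Primrec.eq.comp (Primrec.snd.comp Primrec.fst)
      (primrec_code.comp Primrec.snd)) ?_
    refine PrimrecPred.and (hmem.comp Primrec.snd
      (Primrec.fst.comp (Primrec.fst.comp Primrec.fst))) ?_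
    refine PrimrecPred.and (Primrec.nat_le.comp (Primrec.list_length.comp Primrec.snd)
      (primrec_pow.comp (Primrec.const 2) (Primrec.snd.comp (Primrec.fst.comp Primrec.fst)))) ?_
    exact hsort.comp Primrec.snd
  have hb : Primrec fun q : (List Bool × ℕ) × List Bool =>
      ((uncode (List (List Bool)) q.2).map fun L => decide (P q L)).getD false :=
    Primrec.option_getD.comp (Primrec.option_map (primrec_uncode.comp Primrec.snd) hP.decide)
      (Primrec.const _)
  refine (Primrec.eq.comp hb (Primrec.const true)).of_eq ?_
  rintro ⟨⟨x, l⟩, y⟩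
  rw [isModelCode_iff]
  cases h : uncode (List (List Bool)) y with
  | none => simp
  | some L => simp [P]

/-! ### Running a machine -/

/-- The configuration of `U` after `t` steps, together with the information whether an earlier
configuration was halting. -/
def Machine.runState (U : Machine) (p y : List Bool) (t : ℕ) : U.Cfg × Bool :=
  Nat.rec (U.init p y, false) (fun _ s => (U.step s.1, s.2 || (U.out s.1).isSome)) t

/-- The output of `U` if it halts after exactly `t` steps. -/
def Machine.run (U : Machine) (p y : List Bool) (t : ℕ) : Option (List Bool) :=
  cond (U.runState p y t).2 none (U.out (U.runState p y t).1)

theorem Machine.runState_fst (U : Machine) (p y : List Bool) (t : ℕ) :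
    (U.runState p y t).1 = U.conf p y t := by
  induction t with
  | zero => rfl
  | succ t ih =>
    change U.step (U.runState p y t).1 = _
    rw [ih, Machine.conf, Machine.conf, Function.iterate_succ_apply']

theorem Machine.runState_snd (U : Machine) (p y : List Bool) (t : ℕ) :
    (U.runState p y t).2 = false ↔ ∀ s < t, U.out (U.conf p y s) = none := by
  induction t with
  | zero => simp [Machine.runState]
  | succ t ih =>
    change ((U.runState p y t).2 || (U.out (U.runState p y t).1).isSome) = false ↔ _
    rw [Bool.or_eq_false_iff, ih, U.runState_fst, Nat.forall_lt_succ_right]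
    simp

theorem Machine.run_eq_some_iff (U : Machine) (p y : List Bool) (t : ℕ) (x : List Bool) :
    U.run p y t = some x ↔ U.HaltsAt p y t x := by
  unfold Machine.run Machine.HaltsAt
  rw [← U.runState_snd, U.runState_fst]
  cases h : (U.runState p y t).2 <;> simp

theorem Machine.run_computable (U : Machine) :
    Computable₂ fun (q : List Bool × List Bool) t => U.run q.1 q.2 t := by
  have hs : Computable fun r : (List Bool × List Bool) × ℕ => U.runState r.1.1 r.1.2 r.2 := by
    refine Computable.nat_rec (f := fun r : (List Bool × List Bool) × ℕ => r.2)
      (g := fun r : (List Bool × List Bool) × ℕ => (U.init r.1.1 r.1.2, false))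
      (h := fun _ q => (U.step q.2.1, q.2.2 || (U.out q.2.1).isSome)) Computable.snd ?_ ?_
    · exact Computable.pair (U.init_computable.comp (Computable.fst.comp Computable.fst)
        (Computable.snd.comp Computable.fst)) (Computable.const false)
    · have h1 : Computable fun q : ((List Bool × List Bool) × ℕ) × (ℕ × (U.Cfg × Bool)) =>
          q.2.2.1 := Computable.fst.comp (Computable.snd.comp Computable.snd)
      exact Computable.pair (U.step_computable.comp h1)
        (Primrec.or.to_comp.comp (Computable.snd.comp (Computable.snd.comp Computable.snd))
          (Primrec.option_isSome.to_comp.comp (U.out_computable.comp h1)))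
  exact Computable.cond (Computable.snd.comp hs) (Computable.const _)
    (U.out_computable.comp (Computable.fst.comp hs))

theorem Machine.run_computable' (U : Machine) {α : Type*} [Primcodable α] {p y : α → List Bool}
    {t : α → ℕ} (hp : Computable p) (hy : Computable y) (ht : Computable t) :
    Computable fun a => U.run (p a) (y a) (t a) :=
  U.run_computable.comp (hp.pair hy) ht

theorem Machine.HaltsAt.unique {U : Machine} {p y : List Bool} {s t : ℕ} {x z : List Bool}
    (h : U.HaltsAt p y s x) (h' : U.HaltsAt p y t z) : s = t ∧ x = z := by
  have hst : s = t := by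
    rcases lt_trichotomy s t with hlt | heq | hlt
    · have := h'.2 s hlt
      simp [h.1] at this
    · exact heq
    · have := h.2 t hlt
      simp [h'.1] at this
  subst hst
  have := h.1.symm.trans h'.1
  exact ⟨rfl, by simpa using this⟩

theorem Machine.Outputs.unique {U : Machine} {p y x z : List Bool}
    (h : U.Outputs p y x) (h' : U.Outputs p y z) : x = z := by
  obtain ⟨s, hs⟩ := h
  obtain ⟨t, ht⟩ := h'
  exact (hs.unique ht).2

/-- The partial function that is computed by `U`. -/
def Machine.eval (U : Machine) (p y : List Bool) : Part (List Bool) :=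
  Nat.rfindOpt (U.run p y)

theorem Machine.mem_eval (U : Machine) (p y x : List Bool) : x ∈ U.eval p y ↔ U.Outputs p y x := by
  constructor
  · intro h
    obtain ⟨t, ht⟩ := Nat.rfindOpt_spec h
    exact ⟨t, (U.run_eq_some_iff _ _ _ _).1 ht⟩
  · rintro ⟨t, ht⟩
    have hd : (U.eval p y).Dom := Nat.rfindOpt_dom.2 ⟨t, x, (U.run_eq_some_iff _ _ _ _).2 ht⟩
    obtain ⟨z, hz⟩ := Part.dom_iff_mem.1 hd
    obtain ⟨s, hs⟩ := Nat.rfindOpt_spec hz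
    rwa [← (((U.run_eq_some_iff _ _ _ _).1 hs).unique ht).2]

theorem Machine.eval_partrec (U : Machine) : Partrec₂ U.eval :=
  Partrec.rfindOpt U.run_computable

theorem Machine.rt_eq {U : Machine} {p y x : List Bool} {t : ℕ} (h : U.HaltsAt p y t x) :
    U.rt p y = t := by
  have : {t | ∃ x, U.HaltsAt p y t x} = {t} := by
    ext s
    constructor
    · rintro ⟨z, hz⟩
      exact (hz.unique h).1
    · rintro rfl
      exact ⟨x, h⟩
  rw [Machine.rt, this, csInf_singleton]

theorem condK_le {U : Machine} {p y x : List Bool} (h : U.Outputs p y x) :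
    condK U x y ≤ p.length :=
  Nat.sInf_le ⟨p, h, rfl⟩

/-! ### Kraft's inequality -/

/-- The weight `2⁻ⁿ` of a code word of length `n`. -/
noncomputable def weight (n : ℕ) : ℝ≥0∞ := 2⁻¹ ^ n

theorem weight_add (m n : ℕ) : weight (m + n) = weight m * weight n := pow_add _ _ _

theorem weight_zero : weight 0 = 1 := pow_zero _

theorem two_pow_mul_weight (n : ℕ) : 2 ^ n * weight n = 1 := by
  rw [weight, ← mul_pow, ENNReal.mul_inv_cancel two_ne_zero ENNReal.ofNat_ne_top, one_pow]

theorem weight_ne_zero (n : ℕ) : weight n ≠ 0 :=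
  pow_ne_zero _ (ENNReal.inv_ne_zero.2 ENNReal.ofNat_ne_top)

theorem weight_ne_top (n : ℕ) : weight n ≠ ∞ :=
  ENNReal.pow_ne_top (ENNReal.inv_ne_top.2 two_ne_zero)

theorem mul_weight_le_iff {a b : ℝ≥0∞} (n : ℕ) : a * weight n ≤ b ↔ a ≤ b * 2 ^ n := by
  have h : b = b * 2 ^ n * weight n := by rw [mul_assoc, two_pow_mul_weight, mul_one]
  conv_lhs => rw [h]
  exact ENNReal.mul_le_mul_iff_left (weight_ne_zero n) (weight_ne_top n)

theorem le_mul_weight_iff {a b : ℝ≥0∞} (n : ℕ) : a ≤ b * weight n ↔ a * 2 ^ n ≤ b := by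
  have h : a = a * 2 ^ n * weight n := by rw [mul_assoc, two_pow_mul_weight, mul_one]
  conv_lhs => rw [h]
  exact ENNReal.mul_le_mul_iff_left (weight_ne_zero n) (weight_ne_top n)

theorem weight_le_weight_iff {m n : ℕ} : weight m ≤ weight n ↔ n ≤ m := by
  rw [← one_mul (weight m), mul_weight_le_iff]
  constructor
  · intro h
    by_contra hlt
    push Not at hlt
    obtain ⟨d, rfl⟩ := Nat.exists_eq_add_of_lt hlt
    rw [add_assoc, weight_add, mul_right_comm, mul_comm (weight m), two_pow_mul_weight, one_mul,
      ← not_lt] at h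
    apply h
    rw [weight]
    exact (pow_le_of_le_one (by simp) (by norm_num) (by omega)).trans_lt
      (ENNReal.inv_lt_one.2 ENNReal.one_lt_two)
  · intro h
    obtain ⟨d, rfl⟩ := Nat.exists_eq_add_of_le h
    rw [pow_add, ← mul_assoc, mul_comm (weight n), two_pow_mul_weight, one_mul]
    exact one_le_pow₀ (by norm_num)

theorem PrefixFree.uniquelyDecodable {P : Set (List Bool)} (hP : PrefixFree P) (h0 : [] ∉ P) :
    InformationTheory.UniquelyDecodable P := by
  intro L₁
  induction L₁ with
  | nil =>
    intro L₂ _ h₂ h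
    cases L₂ with
    | nil => rfl
    | cons v L₂ =>
      have hv := h₂ v (by simp)
      simp only [List.flatten_nil, List.flatten_cons] at h
      have : v = [] := (List.append_eq_nil_iff.1 h.symm).1
      exact absurd (this ▸ hv) h0
  | cons u L₁ ih =>
    intro L₂ h₁ h₂ h
    have hu := h₁ u (by simp)
    cases L₂ with
    | nil =>
      simp only [List.flatten_nil, List.flatten_cons] at h
      have : u = [] := (List.append_eq_nil_iff.1 h).1
      exact absurd (this ▸ hu) h0
    | cons v L₂ =>
      have hv := h₂ v (by simp)
      simp only [List.flatten_cons] at h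
      have huv : u = v := by
        rcases List.prefix_or_prefix_of_prefix (List.prefix_append u L₁.flatten)
          (h ▸ List.prefix_append v L₂.flatten) with hp | hp
        · exact hP _ hu _ hv hp
        · exact (hP _ hv _ hu hp).symm
      subst huv
      rw [ih L₂ (fun w hw => h₁ w (by simp [hw])) (fun w hw => h₂ w (by simp [hw]))
        (List.append_cancel_left h)]

/-- Kraft's inequality. -/
theorem PrefixFree.tsum_weight_le_one {P : Set (List Bool)} (hP : PrefixFree P) :
    ∑' p : P, weight p.1.length ≤ 1 := by
  classical
  by_cases h0 : [] ∈ P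
  · have hs : ∀ p : P, p = ⟨[], h0⟩ := fun p =>
      Subtype.ext (hP _ h0 _ p.2 (List.nil_prefix)).symm
    rw [tsum_eq_single ⟨[], h0⟩ fun p hp => absurd (hs p) hp]
    simp [weight]
  · rw [ENNReal.tsum_eq_iSup_sum]
    refine iSup_le fun s => ?_
    have hud : InformationTheory.UniquelyDecodable
        ((s.map (Function.Embedding.subtype _) : Finset (List Bool)) : Set (List Bool)) := by
      intro L₁ L₂ h₁ h₂
      refine hP.uniquelyDecodable h0 L₁ L₂ (fun w hw => ?_) fun w hw => ?_
      · obtain ⟨q, -, rfl⟩ := Finset.mem_map.1 (h₁ w hw)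
        exact q.2
      · obtain ⟨q, -, rfl⟩ := Finset.mem_map.1 (h₂ w hw)
        exact q.2
    have h := InformationTheory.kraft_mcmillan_inequality hud
    rw [Finset.sum_map] at h
    simp only [Function.Embedding.subtype_apply, Fintype.card_bool] at h
    have h2 : ∑ p ∈ s, weight p.1.length
        = ENNReal.ofReal (∑ p ∈ s, (1 / ((2 : ℕ) : ℝ)) ^ p.1.length) := by
      rw [ENNReal.ofReal_sum_of_nonneg fun _ _ => by positivity]
      refine Finset.sum_congr rfl fun p _ => ?_
      rw [weight, ENNReal.ofReal_pow (by positivity)]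
      congr 1
      rw [Nat.cast_ofNat, one_div, ENNReal.ofReal_inv_of_pos two_pos, ENNReal.ofReal_ofNat]
    rw [h2]
    exact ENNReal.ofReal_le_one.2 h

/-- The weight of the program `p` if `U` halts on `(p, y)` after exactly `t` steps, and `0`
otherwise. -/
noncomputable def runWeight (U : Machine) (y p : List Bool) (t : ℕ) : ℝ≥0∞ :=
  if (U.run p y t).isSome then weight p.length else 0

theorem tsum_runWeight_le_one {U : Machine} (hU : U.IsUniversal) (y : List Bool) :
    ∑' (p : List Bool) (t : ℕ), runWeight U y p t ≤ 1 := by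
  classical
  refine le_trans ?_ (hU.prefixFree y).tsum_weight_le_one
  rw [tsum_subtype {p | ∃ x, U.Outputs p y x} fun p => weight p.length]
  refine ENNReal.tsum_le_tsum fun p => ?_
  by_cases h : ∃ x, U.Outputs p y x
  · rw [Set.indicator_of_mem (show p ∈ {p | ∃ x, U.Outputs p y x} from h)]
    obtain ⟨x, t, ht⟩ := h
    rw [tsum_eq_single t]
    · unfold runWeight
      split_ifs <;> simp
    · intro s hs
      unfold runWeight
      rw [if_neg]
      intro hsome
      obtain ⟨z, hz⟩ := Option.isSome_iff_exists.1 hsome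
      exact hs (((U.run_eq_some_iff _ _ _ _).1 hz).unique ht).1
  · have h0 : ∀ t, runWeight U y p t = 0 := by
      intro t
      unfold runWeight
      rw [if_neg]
      intro hsome
      obtain ⟨z, hz⟩ := Option.isSome_iff_exists.1 hsome
      exact h ⟨z, t, (U.run_eq_some_iff _ _ _ _).1 hz⟩
    simp [h0]

/-! ### Partial sums of weights -/

/-- The weight of an optional code word length. -/
noncomputable def optWeight : Option ℕ → ℝ≥0∞
  | none => 0
  | some n => weight n

/-- The partial sum of the weights of the first `N` lengths of a sequence, as a dyadic fraction:
the pair `(a, e)` stands for `a / 2 ^ e`. -/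
def partialSum (m : ℕ → Option ℕ) (N : ℕ) : ℕ × ℕ :=
  Nat.rec (0, 0) (fun i s => ((m i).map fun n => (s.1 * 2 ^ n + 2 ^ s.2, s.2 + n)).getD s) N

theorem partialSum_succ (m : ℕ → Option ℕ) (N : ℕ) : partialSum m (N + 1) =
    ((m N).map fun n => ((partialSum m N).1 * 2 ^ n + 2 ^ (partialSum m N).2,
      (partialSum m N).2 + n)).getD (partialSum m N) := rfl

theorem partialSum_computable {α : Type*} [Primcodable α] {m : α → ℕ → Option ℕ}
    (hm : Computable₂ m) : Computable₂ fun a N => partialSum (m a) N := by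
  refine Computable.nat_rec (f := fun q : α × ℕ => q.2) (g := fun _ => ((0, 0) : ℕ × ℕ))
    (h := fun q s => ((m q.1 s.1).map fun n => (s.2.1 * 2 ^ n + 2 ^ s.2.2, s.2.2 + n)).getD s.2)
    Computable.snd (Computable.const _) ?_
  refine Computable.option_getD (Computable.option_map
    (hm.comp (Computable.fst.comp Computable.fst) (Computable.fst.comp Computable.snd)) ?_)
    (Computable.snd.comp Computable.snd)
  have hs : Primrec fun q : ((α × ℕ) × (ℕ × (ℕ × ℕ))) × ℕ => q.1.2.2 :=
    Primrec.snd.comp (Primrec.snd.comp Primrec.fst)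
  have h1 : Primrec fun q : ((α × ℕ) × (ℕ × (ℕ × ℕ))) × ℕ => q.1.2.2.1 := Primrec.fst.comp hs
  have h2 : Primrec fun q : ((α × ℕ) × (ℕ × (ℕ × ℕ))) × ℕ => q.1.2.2.2 := Primrec.snd.comp hs
  exact (Primrec.pair (Primrec.nat_add.comp
    (Primrec.nat_mul.comp h1 (primrec_pow.comp (Primrec.const 2) Primrec.snd))
    (primrec_pow.comp (Primrec.const 2) h2)) (Primrec.nat_add.comp h2 Primrec.snd)).to_comp

theorem partialSum_val (m : ℕ → Option ℕ) (N : ℕ) :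
    ((partialSum m N).1 : ℝ≥0∞) * weight (partialSum m N).2
      = ∑ i ∈ Finset.range N, optWeight (m i) := by
  induction N with
  | zero => simp [partialSum]
  | succ N ih =>
    rw [Finset.sum_range_succ, ← ih, partialSum_succ]
    cases h : m N with
    | none => simp [optWeight]
    | some n =>
      simp only [Option.map_some, Option.getD_some, optWeight]
      push_cast
      rw [weight_add, add_mul]
      congr 1
      · calc _ = _ * weight (partialSum m N).2 * (2 ^ n * weight n) := by ring
          _ = _ := by rw [two_pow_mul_weight, mul_one]
      · rw [← mul_assoc, two_pow_mul_weight, one_mul]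

/-- Comparison of a partial sum with a dyadic number is comparison of natural numbers. -/
theorem partialSum_le_iff (m : ℕ → Option ℕ) (N c j : ℕ) :
    (partialSum m N).1 * 2 ^ j ≤ 2 ^ (c + (partialSum m N).2) ↔
      ∑ i ∈ Finset.range N, optWeight (m i) ≤ 2 ^ c * weight j := by
  rw [← partialSum_val, mul_weight_le_iff, ← Nat.cast_le (α := ℝ≥0∞)]
  push_cast
  rw [mul_right_comm, le_mul_weight_iff, pow_add]

/-! ### Prefix machines from Kraft sums -/

/-- The real number that a partial sum stands for. -/
noncomputable def partialSumReal (m : ℕ → Option ℕ) (N : ℕ) : ℝ :=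
  ((partialSum m N).1 : ℝ) / 2 ^ (partialSum m N).2

theorem partialSumReal_succ_of_some {m : ℕ → Option ℕ} {i n : ℕ} (h : m i = some n) :
    partialSumReal m (i + 1) = partialSumReal m i + 1 / 2 ^ n := by
  unfold partialSumReal
  rw [partialSum_succ, h]
  simp only [Option.map_some, Option.getD_some]
  push_cast
  rw [pow_add]
  field_simp

theorem partialSumReal_mono (m : ℕ → Option ℕ) : Monotone (partialSumReal m) := by
  refine monotone_nat_of_le_succ fun i => ?_
  cases h : m i with
  | none =>
    unfold partialSumReal
    rw [partialSum_succ, h]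
    simp
  | some n =>
    rw [partialSumReal_succ_of_some h]
    have : (0 : ℝ) < 1 / 2 ^ n := by positivity
    linarith

/-- The code word of length `n + 1` assigned to a request for length `n`, where the pair `s` stands
for the total weight of the preceding requests: it names a dyadic interval of length `2⁻⁽ⁿ⁺¹⁾`
inside the interval of length `2⁻ⁿ` that starts at this total weight. -/
def kraftWord (s : ℕ × ℕ) (n : ℕ) : List Bool :=
  natString (n + 1) ((s.1 * 2 ^ (n + 1) + 2 ^ s.2 - 1) / 2 ^ s.2)

theorem ceil_div_bounds (a b c : ℕ) :
    (a : ℝ) / 2 ^ b * 2 ^ c ≤ ((a * 2 ^ c + 2 ^ b - 1) / 2 ^ b : ℕ) ∧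
      (((a * 2 ^ c + 2 ^ b - 1) / 2 ^ b : ℕ) : ℝ) < (a : ℝ) / 2 ^ b * 2 ^ c + 1 := by
  have hb : 0 < 2 ^ b := by positivity
  have hb' : (0 : ℝ) < 2 ^ b := by positivity
  set q := (a * 2 ^ c + 2 ^ b - 1) / 2 ^ b with hq
  have h1 : q * 2 ^ b ≤ a * 2 ^ c + 2 ^ b - 1 := Nat.div_mul_le_self _ _
  have h2 : a * 2 ^ c + 2 ^ b - 1 < (q + 1) * 2 ^ b := Nat.lt_mul_of_div_lt (Nat.lt_succ_self _) hb
  have h1' : q * 2 ^ b < a * 2 ^ c + 2 ^ b := by omega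
  have h2' : a * 2 ^ c ≤ q * 2 ^ b := by
    rw [add_mul, one_mul] at h2
    omega
  have h1r : (q : ℝ) * 2 ^ b < a * 2 ^ c + 2 ^ b := by exact_mod_cast h1'
  have h2r : (a : ℝ) * 2 ^ c ≤ q * 2 ^ b := by exact_mod_cast h2'
  constructor
  · rw [div_mul_eq_mul_div, div_le_iff₀ hb']
    exact h2r
  · rw [div_mul_eq_mul_div, div_add_one hb'.ne', lt_div_iff₀ hb']
    exact h1r

theorem kraftWord_interval {m : ℕ → Option ℕ} {i n : ℕ} (h : m i = some n)
    (hfit : (partialSum m (i + 1)).1 ≤ 2 ^ (partialSum m (i + 1)).2) :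
    ∃ a < 2 ^ (n + 1), kraftWord (partialSum m i) n = natString (n + 1) a ∧
      partialSumReal m i * 2 ^ (n + 1) ≤ a ∧ (a : ℝ) < partialSumReal m i * 2 ^ (n + 1) + 1 := by
  obtain ⟨h1, h2⟩ := ceil_div_bounds (partialSum m i).1 (partialSum m i).2 (n + 1)
  refine ⟨_, ?_, rfl, h1, h2⟩
  have h3 : partialSumReal m (i + 1) ≤ 1 := by
    rw [partialSumReal, div_le_one (by positivity)]
    exact_mod_cast hfit
  rw [partialSumReal_succ_of_some h, ← le_sub_iff_add_le] at h3
  have h4 : partialSumReal m i * 2 ^ (n + 1) + 2 ≤ 2 ^ (n + 1) := by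
    calc partialSumReal m i * 2 ^ (n + 1) + 2 ≤ (1 - 1 / 2 ^ n) * 2 ^ (n + 1) + 2 := by gcongr
      _ = 2 ^ (n + 1) := by rw [pow_succ]; field_simp; ring
  rw [← Nat.cast_lt (α := ℝ)]
  push_cast
  exact h2.trans (by unfold partialSumReal at h4; linarith)

/-- The code words of different requests are incomparable, because the intervals that they name
are disjoint. -/
theorem kraftWord_not_prefix {m : ℕ → Option ℕ} {i j n k : ℕ} (hij : i < j)
    (hi : m i = some n) (hj : m j = some k)
    (hfi : (partialSum m (i + 1)).1 ≤ 2 ^ (partialSum m (i + 1)).2)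
    (hfj : (partialSum m (j + 1)).1 ≤ 2 ^ (partialSum m (j + 1)).2) :
    ¬ kraftWord (partialSum m i) n <+: kraftWord (partialSum m j) k ∧
      ¬ kraftWord (partialSum m j) k <+: kraftWord (partialSum m i) n := by
  obtain ⟨a, ha, hwa, ha1, ha2⟩ := kraftWord_interval hi hfi
  obtain ⟨b, hb, hwb, hb1, -⟩ := kraftWord_interval hj hfj
  have hmono : partialSumReal m i + 1 / 2 ^ n ≤ partialSumReal m j := by
    rw [← partialSumReal_succ_of_some hi]
    exact partialSumReal_mono m hij
  rw [hwa, hwb]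
  constructor
  · intro hp
    obtain ⟨hle, hab⟩ := div_eq_of_natString_prefix ha hb hp
    obtain ⟨d, hd⟩ := Nat.exists_eq_add_of_le hle
    rw [hd, Nat.add_sub_cancel_left] at hab
    have h1 : b < (a + 1) * 2 ^ d :=
      Nat.lt_mul_of_div_lt (hab ▸ Nat.lt_succ_self _) (by positivity)
    have h1' : b + 1 ≤ (a + 1) * 2 ^ d := h1
    have h1r : (b : ℝ) + 1 ≤ (a + 1) * 2 ^ d := by exact_mod_cast h1'
    have h2 : (partialSumReal m i + 1 / 2 ^ n) * 2 ^ (k + 1) ≤ b :=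
      (mul_le_mul_of_nonneg_right hmono (by positivity)).trans hb1
    have h3 : (partialSumReal m i + 1 / 2 ^ n) * 2 ^ (k + 1)
        = (partialSumReal m i * 2 ^ (n + 1) + 2) * 2 ^ d := by
      rw [hd, pow_add, pow_succ]
      field_simp
    have h4 : ((a : ℝ) + 1) * 2 ^ d ≤ (partialSumReal m i * 2 ^ (n + 1) + 2) * 2 ^ d :=
      mul_le_mul_of_nonneg_right (by linarith) (by positivity)
    linarith
  · intro hp
    obtain ⟨hle, hab⟩ := div_eq_of_natString_prefix hb ha hp
    obtain ⟨d, hd⟩ := Nat.exists_eq_add_of_le hle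
    rw [hd, Nat.add_sub_cancel_left] at hab
    have h1 : b * 2 ^ d ≤ a := hab ▸ Nat.div_mul_le_self _ _
    have h1r : (b : ℝ) * 2 ^ d ≤ a := by exact_mod_cast h1
    have h2 : (partialSumReal m i + 1 / 2 ^ n) * 2 ^ (k + 1) * 2 ^ d ≤ b * 2 ^ d :=
      mul_le_mul_of_nonneg_right
        ((mul_le_mul_of_nonneg_right hmono (by positivity)).trans hb1) (by positivity)
    have h3 : (partialSumReal m i + 1 / 2 ^ n) * 2 ^ (k + 1) * 2 ^ d
        = partialSumReal m i * 2 ^ (n + 1) + 2 := by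
      rw [mul_assoc, ← pow_add, ← hd, pow_succ]
      field_simp
    linarith

/-- The output of the `i`-th request of the sequence `r y`, if the requests up to this one have
total weight at most `1` and its code word is `p`. -/
def kraftOutput (r : List Bool → ℕ → Option (ℕ × List Bool)) (y p : List Bool) (i : ℕ) :
    Option (List Bool) :=
  (r y i).bind fun a =>
    bif decide ((partialSum (fun j => (r y j).map Prod.fst) (i + 1)).1 ≤
          2 ^ (partialSum (fun j => (r y j).map Prod.fst) (i + 1)).2) &&
        decide (kraftWord (partialSum (fun j => (r y j).map Prod.fst) i) a.1 = p)
    then some a.2 else none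

theorem kraftOutput_eq_some_iff {r : List Bool → ℕ → Option (ℕ × List Bool)} {y p x : List Bool}
    {i : ℕ} : kraftOutput r y p i = some x ↔ ∃ n, r y i = some (n, x) ∧
      (partialSum (fun j => (r y j).map Prod.fst) (i + 1)).1 ≤
          2 ^ (partialSum (fun j => (r y j).map Prod.fst) (i + 1)).2 ∧
        kraftWord (partialSum (fun j => (r y j).map Prod.fst) i) n = p := by
  unfold kraftOutput
  rcases h : r y i with _ | ⟨n, z⟩
  · simp
  · simp only [Option.bind_some, Bool.cond_eq_ite, Bool.and_eq_true, decide_eq_true_eq]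
    constructor
    · intro hh
      split_ifs at hh with hc
      obtain rfl : z = x := by simpa using hh
      exact ⟨n, rfl, hc⟩
    · rintro ⟨n', h1, h2⟩
      simp only [Option.some.injEq, Prod.mk.injEq] at h1
      obtain ⟨rfl, rfl⟩ := h1
      rw [if_pos h2]

theorem kraftOutput_computable {r : List Bool → ℕ → Option (ℕ × List Bool)}
    (hr : Computable₂ r) :
    Computable₂ fun (q : List Bool × List Bool) i => kraftOutput r q.2 q.1 i := by
  have hps : Computable₂ fun (y : List Bool) (N : ℕ) =>
      partialSum (fun j => (r y j).map Prod.fst) N :=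
    partialSum_computable (m := fun y j => (r y j).map Prod.fst)
      (Computable.option_map hr (Computable.fst.comp Computable.snd).to₂)
  have hw : Primrec₂ kraftWord := by
    have hs1 : Primrec fun q : (ℕ × ℕ) × ℕ => q.1.1 := Primrec.fst.comp Primrec.fst
    have hs2 : Primrec fun q : (ℕ × ℕ) × ℕ => 2 ^ q.1.2 :=
      primrec_pow.comp (Primrec.const 2) (Primrec.snd.comp Primrec.fst)
    have hn : Primrec fun q : (ℕ × ℕ) × ℕ => q.2 + 1 := Primrec.succ.comp Primrec.snd
    refine primrec_natString.comp hn (Primrec.nat_div.comp (Primrec.nat_sub.comp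
      (Primrec.nat_add.comp (Primrec.nat_mul.comp hs1 ?_) hs2) (Primrec.const 1)) hs2)
    exact primrec_pow.comp (Primrec.const 2) hn
  have hle : Primrec fun s : ℕ × ℕ => decide (s.1 ≤ 2 ^ s.2) :=
    (Primrec.nat_le.comp Primrec.fst
      (primrec_pow.comp (Primrec.const 2) Primrec.snd)).decide
  have heq : Primrec₂ fun (w p : List Bool) => decide (w = p) := Primrec.eq.decide
  refine Computable.option_bind
    (f := fun q : (List Bool × List Bool) × ℕ => r q.1.2 q.2)
    (hr.comp (Computable.snd.comp Computable.fst) Computable.snd) ?_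
  have hy : Computable fun q : ((List Bool × List Bool) × ℕ) × (ℕ × List Bool) => q.1.1.2 :=
    Computable.snd.comp (Computable.fst.comp Computable.fst)
  have hp : Computable fun q : ((List Bool × List Bool) × ℕ) × (ℕ × List Bool) => q.1.1.1 :=
    Computable.fst.comp (Computable.fst.comp Computable.fst)
  have hi : Computable fun q : ((List Bool × List Bool) × ℕ) × (ℕ × List Bool) => q.1.2 :=
    Computable.snd.comp Computable.fst
  refine Computable.cond (Primrec.and.to_comp.comp
    (hle.to_comp.comp (hps.comp hy (Computable.succ.comp hi)))
    (heq.to_comp.comp (hw.to_comp.comp (hps.comp hy hi)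
      (Computable.fst.comp Computable.snd)) hp))
    (Computable.option_some.comp (Computable.snd.comp Computable.snd)) (Computable.const none)

/-- The weight of an optional request. -/
noncomputable def reqWeight (a : Option (ℕ × List Bool)) : ℝ≥0∞ := optWeight (a.map Prod.fst)

/-- The Kraft–Chaitin theorem for a sequence of requests. -/
theorem condK_le_of_request_nat {U : Machine} (hU : U.IsUniversal)
    {r : List Bool → ℕ → Option (ℕ × List Bool)} (hr : Computable₂ r) :
    ∃ c : ℕ, ∀ y, ∑' i, reqWeight (r y i) ≤ 1 →
      ∀ i n x, r y i = some (n, x) → ∃ q, U.Outputs q y x ∧ q.length ≤ n + c := by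
  obtain ⟨c, hc⟩ := hU.simulates (fun p y => Nat.rfindOpt (kraftOutput r y p))
    (Partrec.rfindOpt (kraftOutput_computable hr)) (by
      intro y p hp q hq hpq
      obtain ⟨i, x, hi⟩ := Nat.rfindOpt_dom.1 hp
      obtain ⟨j, z, hj⟩ := Nat.rfindOpt_dom.1 hq
      obtain ⟨n, hn, hfi, rfl⟩ := kraftOutput_eq_some_iff.1 hi
      obtain ⟨k, hk, hfj, rfl⟩ := kraftOutput_eq_some_iff.1 hj
      rcases lt_trichotomy i j with h | rfl | h
      · exact absurd hpq (kraftWord_not_prefix h (by simp [hn]) (by simp [hk]) hfi hfj).1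
      · have : n = k := by simpa using congrArg (Option.map Prod.fst) (hn.symm.trans hk)
        rw [this]
      · exact absurd hpq (kraftWord_not_prefix h (by simp [hk]) (by simp [hn]) hfj hfi).2)
  refine ⟨1 + c, fun y hy i n x hi => ?_⟩
  set m : ℕ → Option ℕ := fun j => (r y j).map Prod.fst with hm
  have hfit : ∀ N, (partialSum m N).1 ≤ 2 ^ (partialSum m N).2 := by
    intro N
    have := (partialSum_le_iff m N 0 0).2 (by
      rw [pow_zero, weight_zero, one_mul]
      exact (ENNReal.sum_le_tsum (f := fun i => reqWeight (r y i)) (Finset.range N)).trans hy)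
    simpa using this
  have hout : kraftOutput r y (kraftWord (partialSum m i) n) i = some x :=
    kraftOutput_eq_some_iff.2 ⟨n, hi, hfit _, rfl⟩
  have hmem : x ∈ Nat.rfindOpt (kraftOutput r y (kraftWord (partialSum m i) n)) := by
    obtain ⟨z, hz⟩ := Part.dom_iff_mem.1 (Nat.rfindOpt_dom.2 ⟨i, x, hout⟩)
    obtain ⟨j, hj⟩ := Nat.rfindOpt_spec hz
    obtain ⟨k, hk, -, hw⟩ := kraftOutput_eq_some_iff.1 hj
    have hij : i = j := by
      rcases lt_trichotomy i j with h | h | h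
      · exact absurd ⟨[], (List.append_nil _).trans hw.symm⟩
          (kraftWord_not_prefix (m := m) (n := n) (k := k) h (by simp [hm, hi]) (by simp [hm, hk])
            (hfit _) (hfit _)).1
      · exact h
      · exact absurd ⟨[], (List.append_nil _).trans hw⟩
          (kraftWord_not_prefix (m := m) (n := k) (k := n) h (by simp [hm, hk]) (by simp [hm, hi])
            (hfit _) (hfit _)).1
    subst hij
    obtain rfl : x = z := by simpa using congrArg (Option.map Prod.snd) (hi.symm.trans hk)
    exact hz
  obtain ⟨q, hq, hlen⟩ := hc _ _ _ hmem
  refine ⟨q, hq, hlen.trans ?_⟩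
  simp [kraftWord]
  omega

/-- Requests that are indexed by natural numbers instead of the elements of a type. -/
def natRequests {α : Type*} [Encodable α] (r : List Bool → α → Option (ℕ × List Bool))
    (y : List Bool) (i : ℕ) : Option (ℕ × List Bool) :=
  (Encodable.decode₂ α i).bind (r y)

theorem natRequests_encode {α : Type*} [Encodable α] (r : List Bool → α → Option (ℕ × List Bool))
    (y : List Bool) (a : α) : natRequests r y (Encodable.encode a) = r y a := by
  simp [natRequests]

theorem natRequests_computable {α : Type*} [Primcodable α]
    {r : List Bool → α → Option (ℕ × List Bool)} (hr : Computable₂ r) :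
    Computable₂ (natRequests r) :=
  Computable.option_bind (Primrec.decode₂.to_comp.comp Computable.snd)
    (hr.comp (Computable.fst.comp Computable.fst) Computable.snd)

/-- Sums over the requests do not depend on how the requests are indexed. -/
theorem tsum_natRequests {α : Type*} [Encodable α] (r : List Bool → α → Option (ℕ × List Bool))
    (y : List Bool) (f : Option (ℕ × List Bool) → ℝ≥0∞) (hf : f none = 0) :
    ∑' i, f (natRequests r y i) = ∑' a, f (r y a) := by
  rw [← Function.Injective.tsum_eq (Encodable.encode_injective (α := α))]
  · simp only [natRequests_encode]
  · intro i hi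
    rw [Function.mem_support] at hi
    cases h : Encodable.decode₂ α i with
    | none => simp [natRequests, h, hf] at hi
    | some a => exact ⟨a, Encodable.mem_decode₂.1 h⟩

/-- The Kraft–Chaitin theorem: if `r y` is a computable family of requests of total weight at most
`1`, then each request `(n, x)` in it bounds `K(x | y)` by `n`, up to a constant that depends only
on `r`. -/
theorem condK_le_of_request {U : Machine} (hU : U.IsUniversal) {α : Type*} [Primcodable α]
    {r : List Bool → α → Option (ℕ × List Bool)} (hr : Computable₂ r) :
    ∃ c : ℕ, ∀ y, ∑' a, reqWeight (r y a) ≤ 1 →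
      ∀ a n x, r y a = some (n, x) → ∃ q, U.Outputs q y x ∧ q.length ≤ n + c := by
  obtain ⟨c, hc⟩ := condK_le_of_request_nat hU (natRequests_computable hr)
  refine ⟨c, fun y hy a n x h => hc y ?_ (Encodable.encode a) n x (by rwa [natRequests_encode])⟩
  rwa [tsum_natRequests r y reqWeight rfl]

/-! ### The coding theorem -/

/-- The length of a request if it is a request for `x`. -/
def lengthFor (x : List Bool) (a : Option (ℕ × List Bool)) : Option ℕ :=
  a.bind fun b => bif decide (b.2 = x) then some b.1 else none

theorem lengthFor_eq_some_iff {x : List Bool} {a : Option (ℕ × List Bool)} {n : ℕ} :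
    lengthFor x a = some n ↔ a = some (n, x) := by
  rcases a with _ | ⟨k, z⟩
  · simp [lengthFor]
  · by_cases h : z = x <;> simp [lengthFor, h]

theorem lengthFor_computable {α : Type*} [Primcodable α] {x : α → List Bool}
    {a : α → Option (ℕ × List Bool)} (hx : Computable x) (ha : Computable a) :
    Computable fun q => lengthFor (x q) (a q) := by
  refine Computable.option_bind ha ?_
  refine Computable.cond ?_ (Computable.option_some.comp (Computable.fst.comp Computable.snd))
    (Computable.const none)
  exact (Primrec.eq (α := List Bool)).decide.to_comp.comp
    (Computable.snd.comp Computable.snd) (hx.comp Computable.fst)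

theorem tsum_optWeight_lengthFor (a : Option (ℕ × List Bool)) :
    ∑' x, optWeight (lengthFor x a) = reqWeight a := by
  rcases a with _ | ⟨n, z⟩
  · simp [lengthFor, optWeight, reqWeight]
  · rw [tsum_eq_single z]
    · simp [lengthFor, reqWeight]
    · intro x hx
      simp [lengthFor, hx.symm, optWeight]

/-- For a dyadic fraction `0 < a / 2 ^ e ≤ 1`, the least `l` with `2⁻ˡ ≤ a / 2 ^ e`. -/
def dyadicLevel (s : ℕ × ℕ) : ℕ := s.2 + 1 - s.1.bits.length

theorem primrec_dyadicLevel : Primrec dyadicLevel :=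
  Primrec.nat_sub.comp (Primrec.succ.comp Primrec.snd)
    (Primrec.list_length.comp (primrec_bits.comp Primrec.fst))

theorem dyadicLevel_spec {a e : ℕ} (ha : a ≠ 0) (hle : a ≤ 2 ^ e) :
    2 ^ e ≤ a * 2 ^ dyadicLevel (a, e) ∧ a * 2 ^ dyadicLevel (a, e) < 2 ^ (e + 1) := by
  unfold dyadicLevel
  simp only [Nat.size_eq_bits_len]
  have h1 : a < 2 ^ a.size := Nat.lt_size_self a
  have h2 : a.size ≤ e + 1 :=
    Nat.size_le.2 (hle.trans_lt (Nat.pow_lt_pow_right one_lt_two (Nat.lt_succ_self e)))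
  have h3 : 0 < a.size := Nat.size_pos.2 (Nat.pos_of_ne_zero ha)
  have h4 : 2 ^ (a.size - 1) ≤ a := Nat.lt_size.1 (by omega)
  constructor
  · calc 2 ^ e = 2 ^ (a.size - 1) * 2 ^ (e + 1 - a.size) := by rw [← pow_add]; congr 1; omega
      _ ≤ _ := Nat.mul_le_mul_right _ h4
  · calc a * 2 ^ (e + 1 - a.size) < 2 ^ a.size * 2 ^ (e + 1 - a.size) :=
        Nat.mul_lt_mul_of_pos_right h1 (by positivity)
      _ = 2 ^ (e + 1) := by rw [← pow_add]; congr 1; omega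

theorem dyadicLevel_anti {a e b f : ℕ} (ha : a ≠ 0) (hae : a ≤ 2 ^ e) (hb : b ≠ 0)
    (hbf : b ≤ 2 ^ f) (h : a * 2 ^ f ≤ b * 2 ^ e) :
    dyadicLevel (b, f) ≤ dyadicLevel (a, e) := by
  obtain ⟨h1, -⟩ := dyadicLevel_spec ha hae
  obtain ⟨-, h2⟩ := dyadicLevel_spec hb hbf
  by_contra hlt
  push Not at hlt
  have h3 : b * 2 ^ (dyadicLevel (a, e) + 1) < 2 ^ (f + 1) :=
    (Nat.mul_le_mul_left _ (Nat.pow_le_pow_right two_pos hlt)).trans_lt h2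
  rw [pow_succ, pow_succ, ← mul_assoc] at h3
  have h4 : b * 2 ^ dyadicLevel (a, e) < 2 ^ f := Nat.lt_of_mul_lt_mul_right h3
  have h5 : b * 2 ^ dyadicLevel (a, e) * 2 ^ e < 2 ^ f * 2 ^ e :=
    Nat.mul_lt_mul_of_pos_right h4 (by positivity)
  have h6 : 2 ^ f * 2 ^ e ≤ b * 2 ^ dyadicLevel (a, e) * 2 ^ e := by
    calc 2 ^ f * 2 ^ e ≤ 2 ^ f * (a * 2 ^ dyadicLevel (a, e)) := Nat.mul_le_mul_left _ h1
      _ = a * 2 ^ f * 2 ^ dyadicLevel (a, e) := by ring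
      _ ≤ b * 2 ^ e * 2 ^ dyadicLevel (a, e) := Nat.mul_le_mul_right _ h
      _ = _ := by ring
  omega

theorem dyadicLevel_weight {a e : ℕ} (ha : a ≠ 0) (hle : a ≤ 2 ^ e) :
    weight (dyadicLevel (a, e)) ≤ a * weight e ∧
      a * weight e ≤ 2 * weight (dyadicLevel (a, e)) := by
  obtain ⟨h1, h2⟩ := dyadicLevel_spec ha hle
  constructor
  · rw [le_mul_weight_iff, mul_comm, ← one_mul (2 ^ e * _), ← mul_assoc, mul_weight_le_iff, one_mul]
    exact_mod_cast h1
  · rw [mul_weight_le_iff, mul_right_comm, le_mul_weight_iff, ← pow_succ']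
    exact_mod_cast h2.le

/-- The total weight, as a dyadic fraction, of the requests for `x` among the first `N` ones. -/
def massFor (r : ℕ → Option (ℕ × List Bool)) (x : List Bool) (N : ℕ) : ℕ × ℕ :=
  partialSum (fun j => lengthFor x (r j)) N

theorem massFor_computable {α : Type*} [Primcodable α] {r : α → ℕ → Option (ℕ × List Bool)}
    {x : α → List Bool} {N : α → ℕ} (hr : Computable₂ r) (hx : Computable x) (hN : Computable N) :
    Computable fun q => massFor (r q) (x q) (N q) := by
  have h : Computable₂ fun (q : α) (i : ℕ) => lengthFor (x q) (r q i) :=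
    lengthFor_computable (hx.comp Computable.fst) hr
  exact (partialSum_computable h).comp Computable.id hN

/-- Requests for the strings `x` whose mass, that is the total weight of the requests for `x`,
reaches a new power of two. Each `x` is requested with a length that corresponds to its mass. -/
def massRequests (r : ℕ → Option (ℕ × List Bool)) (i : ℕ) : Option (ℕ × List Bool) :=
  (r i).bind fun a =>
    bif decide ((massFor r a.2 i).1 = 0) ||
        decide (dyadicLevel (massFor r a.2 (i + 1)) < dyadicLevel (massFor r a.2 i))
    then some (dyadicLevel (massFor r a.2 (i + 1)) + 1, a.2) else none

theorem massRequests_computable {r : List Bool → ℕ → Option (ℕ × List Bool)}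
    (hr : Computable₂ r) : Computable₂ fun y i => massRequests (r y) i := by
  refine Computable.option_bind hr ?_
  have hx : Computable fun q : (List Bool × ℕ) × (ℕ × List Bool) => q.2.2 :=
    Computable.snd.comp Computable.snd
  have hi : Computable fun q : (List Bool × ℕ) × (ℕ × List Bool) => q.1.2 :=
    Computable.snd.comp Computable.fst
  have hrr : Computable₂ fun (q : (List Bool × ℕ) × (ℕ × List Bool)) i => r q.1.1 i :=
    hr.comp (Computable.fst.comp (Computable.fst.comp Computable.fst)) Computable.snd
  have h1 := massFor_computable hrr hx hi
  have h2 := massFor_computable hrr hx (Computable.succ.comp hi)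
  have hl := primrec_dyadicLevel.to_comp
  refine Computable.cond (Primrec.or.to_comp.comp ?_ ?_) (Computable.option_some.comp
    (Computable.pair (Computable.succ.comp (hl.comp h2)) hx)) (Computable.const none)
  · exact (Primrec.eq (α := ℕ)).decide.to_comp.comp (Computable.fst.comp h1) (Computable.const 0)
  · exact Primrec.nat_lt.decide.to_comp.comp (hl.comp h2) (hl.comp h1)

section
variable {r : ℕ → Option (ℕ × List Bool)}

theorem massFor_val (r : ℕ → Option (ℕ × List Bool)) (x : List Bool) (N : ℕ) :
    ((massFor r x N).1 : ℝ≥0∞) * weight (massFor r x N).2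
      = ∑ i ∈ Finset.range N, optWeight (lengthFor x (r i)) :=
  partialSum_val _ _

theorem massFor_le (h : ∑' i, reqWeight (r i) ≤ 1) (x : List Bool) (N : ℕ) :
    (massFor r x N).1 ≤ 2 ^ (massFor r x N).2 := by
  have := (partialSum_le_iff (fun j => lengthFor x (r j)) N 0 0).2 (by
    rw [pow_zero, weight_zero, one_mul]
    refine (ENNReal.sum_le_tsum (f := fun i => optWeight (lengthFor x (r i)))
      (Finset.range N)).trans (le_trans (ENNReal.tsum_le_tsum fun i => ?_) h)
    rw [← tsum_optWeight_lengthFor]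
    exact ENNReal.le_tsum x)
  simpa [massFor] using this

theorem massFor_succ_of_some {x : List Bool} {n N : ℕ} (h : r N = some (n, x)) :
    massFor r x (N + 1) = ((massFor r x N).1 * 2 ^ n + 2 ^ (massFor r x N).2,
      (massFor r x N).2 + n) := by
  unfold massFor
  rw [partialSum_succ, lengthFor_eq_some_iff.2 h]
  rfl

theorem massFor_succ_of_ne {x : List Bool} {N : ℕ} (h : lengthFor x (r N) = none) :
    massFor r x (N + 1) = massFor r x N := by
  unfold massFor
  rw [partialSum_succ, h]
  rfl

theorem lengthFor_massRequests_of_none {x : List Bool} {N : ℕ} (h : lengthFor x (r N) = none) :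
    lengthFor x (massRequests r N) = none := by
  unfold massRequests
  rcases hr : r N with _ | ⟨n, z⟩
  · simp [lengthFor]
  · have hz : z ≠ x := by
      rintro rfl
      rw [lengthFor_eq_some_iff.2 hr] at h
      simp at h
    simp only [Option.bind_some, Bool.cond_eq_ite]
    split_ifs <;> simp [lengthFor, hz]

theorem lengthFor_massRequests_of_some {x : List Bool} {n N : ℕ} (h : r N = some (n, x)) :
    lengthFor x (massRequests r N) = if (massFor r x N).1 = 0 ∨
        dyadicLevel (massFor r x (N + 1)) < dyadicLevel (massFor r x N)
      then some (dyadicLevel (massFor r x (N + 1)) + 1) else none := by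
  unfold massRequests
  rw [h]
  simp only [Option.bind_some, Bool.cond_eq_ite, Bool.or_eq_true, decide_eq_true_eq]
  split_ifs <;> simp [lengthFor]

theorem dyadicLevel_massFor_succ_le (h : ∑' i, reqWeight (r i) ≤ 1) {x : List Bool} {n N : ℕ}
    (hN : r N = some (n, x)) (h0 : (massFor r x N).1 ≠ 0) :
    dyadicLevel (massFor r x (N + 1)) ≤ dyadicLevel (massFor r x N) := by
  have h1 := massFor_le h x N
  have h2 := massFor_le h x (N + 1)
  rw [massFor_succ_of_some hN] at h2 ⊢
  refine dyadicLevel_anti h0 h1 (by positivity) h2 ?_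
  calc (massFor r x N).1 * 2 ^ ((massFor r x N).2 + n)
      = (massFor r x N).1 * 2 ^ n * 2 ^ (massFor r x N).2 := by rw [pow_add]; ring
    _ ≤ _ := Nat.mul_le_mul_right _ (Nat.le_add_right _ _)

/-- The lengths that are requested for `x` are distinct, so that the total weight of the new
requests for `x` is at most twice the weight of the last one, which is half of the greatest power
of two below the mass of `x`. -/
theorem sum_massRequests_le (h : ∑' i, reqWeight (r i) ≤ 1) (x : List Bool) (N : ℕ) :
    ∑ i ∈ Finset.range N, optWeight (lengthFor x (massRequests r i)) ≤
      if (massFor r x N).1 = 0 then 0 else weight (dyadicLevel (massFor r x N)) := by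
  induction N with
  | zero => simp
  | succ N ih =>
    rw [Finset.sum_range_succ]
    cases hl : lengthFor x (r N) with
    | none =>
      rw [lengthFor_massRequests_of_none hl, massFor_succ_of_ne hl]
      simpa [optWeight] using ih
    | some n =>
      have hN := lengthFor_eq_some_iff.1 hl
      have hpos : (massFor r x (N + 1)).1 ≠ 0 := by
        rw [massFor_succ_of_some hN]
        positivity
      have hhalf : ∀ l, weight l = weight (l + 1) + weight (l + 1) := by
        intro l
        rw [weight_add, weight, weight, ← mul_add, pow_one, ENNReal.inv_two_add_inv_two, mul_one]
      rw [lengthFor_massRequests_of_some hN, if_neg hpos]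
      by_cases h0 : (massFor r x N).1 = 0
      · rw [if_pos h0] at ih
        rw [if_pos (Or.inl h0), nonpos_iff_eq_zero.1 ih, zero_add, optWeight,
          weight_le_weight_iff]
        omega
      · rw [if_neg h0] at ih
        by_cases h1 : dyadicLevel (massFor r x (N + 1)) < dyadicLevel (massFor r x N)
        · rw [if_pos (Or.inr h1), hhalf, optWeight]
          gcongr
          exact ih.trans (weight_le_weight_iff.2 h1)
        · rw [if_neg (by tauto), optWeight, add_zero]
          exact ih.trans (weight_le_weight_iff.2 (dyadicLevel_massFor_succ_le h hN h0))

theorem tsum_massRequests_le (h : ∑' i, reqWeight (r i) ≤ 1) :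
    ∑' i, reqWeight (massRequests r i) ≤ 1 := by
  refine le_trans ?_ h
  simp only [← tsum_optWeight_lengthFor]
  rw [ENNReal.tsum_comm, ENNReal.tsum_comm (α := ℕ)]
  refine ENNReal.tsum_le_tsum fun x => ?_
  rw [ENNReal.tsum_eq_iSup_nat]
  refine iSup_le fun N => (sum_massRequests_le h x N).trans ?_
  split_ifs with h0
  · exact zero_le
  · refine (dyadicLevel_weight h0 (massFor_le h x N)).1.trans ?_
    rw [massFor_val]
    exact ENNReal.sum_le_tsum _

/-- The last request for `x` has the length that corresponds to the current mass of `x`. -/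
theorem exists_massRequest (h : ∑' i, reqWeight (r i) ≤ 1) (x : List Bool) (N : ℕ)
    (h0 : (massFor r x N).1 ≠ 0) :
    ∃ i, massRequests r i = some (dyadicLevel (massFor r x N) + 1, x) := by
  induction N with
  | zero => simp [massFor, partialSum] at h0
  | succ N ih =>
    cases hl : lengthFor x (r N) with
    | none =>
      rw [massFor_succ_of_ne hl] at h0 ⊢
      exact ih h0
    | some n =>
      have hN := lengthFor_eq_some_iff.1 hl
      by_cases h1 : (massFor r x N).1 = 0 ∨
        dyadicLevel (massFor r x (N + 1)) < dyadicLevel (massFor r x N)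
      · refine ⟨N, lengthFor_eq_some_iff.1 ?_⟩
        rw [lengthFor_massRequests_of_some hN, if_pos h1]
      · push Not at h1
        have := dyadicLevel_massFor_succ_le h hN h1.1
        rw [le_antisymm this h1.2]
        exact ih h1.1

end

/-- The coding theorem for a sequence of requests. -/
theorem coding_theorem_nat {U : Machine} (hU : U.IsUniversal)
    {r : List Bool → ℕ → Option (ℕ × List Bool)} (hr : Computable₂ r) :
    ∃ c : ℕ, ∀ y, ∑' i, reqWeight (r y i) ≤ 1 →
      ∀ x, ∑' i, optWeight (lengthFor x (r y i)) ≤ 2 ^ c * weight (condK U x y) := by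
  obtain ⟨c, hc⟩ := condK_le_of_request_nat hU (massRequests_computable hr)
  refine ⟨c + 2, fun y hy x => ?_⟩
  rw [ENNReal.tsum_eq_iSup_nat]
  refine iSup_le fun N => ?_
  rw [← massFor_val]
  by_cases h0 : (massFor (r y) x N).1 = 0
  · simp [h0]
  · obtain ⟨i, hi⟩ := exists_massRequest hy x N h0
    obtain ⟨q, hq, hlen⟩ := hc y (tsum_massRequests_le hy) i _ _ hi
    refine (dyadicLevel_weight h0 (massFor_le hy x N)).2.trans ?_
    set l := dyadicLevel (massFor (r y) x N)
    -- one factor `2` is lost in `dyadicLevel_weight` and one in the length of the request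
    have h1 : weight (l + 1 + c) ≤ weight (condK U x y) :=
      weight_le_weight_iff.2 ((condK_le hq).trans hlen)
    calc 2 * weight l = 2 ^ (c + 2) * weight (l + 1 + c) := by
          rw [add_assoc, weight_add, mul_comm (weight l), ← mul_assoc, pow_succ' (2 : ℝ≥0∞) (c + 1),
            mul_assoc 2, add_comm 1 c, two_pow_mul_weight, mul_one]
      _ ≤ _ := by gcongr

/-- The coding theorem: in a computable family of requests of total weight at most `1`, the
requests for `x` have total weight `O(2 ^ (-K(x | y)))`. -/
theorem coding_theorem {U : Machine} (hU : U.IsUniversal) {α : Type*} [Primcodable α]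
    {r : List Bool → α → Option (ℕ × List Bool)} (hr : Computable₂ r) :
    ∃ c : ℕ, ∀ y, ∑' a, reqWeight (r y a) ≤ 1 →
      ∀ x, ∑' a, optWeight (lengthFor x (r y a)) ≤ 2 ^ c * weight (condK U x y) := by
  obtain ⟨c, hc⟩ := coding_theorem_nat hU (natRequests_computable hr)
  refine ⟨c, fun y hy x => ?_⟩
  rw [← tsum_natRequests r y reqWeight rfl] at hy
  rw [← tsum_natRequests r y (fun a => optWeight (lengthFor x a)) rfl]
  exact hc y hy x

/-! ### Elementary upper bounds on complexity -/

/-- Kraft's inequality for the self-delimiting code that describes a string of length `k` by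
`2 k + 1` bits. -/
theorem tsum_selfDelimiting_le_one :
    ∑' (k : ℕ) (j : ℕ), (if j < 2 ^ k then weight (2 * k + 1) else 0) ≤ 1 := by
  have h : ∀ k : ℕ, ∑' j : ℕ, (if j < 2 ^ k then weight (2 * k + 1) else 0) = 2⁻¹ ^ k * 2⁻¹ := by
    intro k
    rw [tsum_eq_sum (s := Finset.range (2 ^ k)) fun j hj => if_neg (by simpa using hj),
      Finset.sum_congr rfl fun j hj => if_pos (by simpa using hj), Finset.sum_const,
      Finset.card_range, nsmul_eq_mul, show 2 * k + 1 = k + (k + 1) by omega, weight_add]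
    push_cast
    rw [← mul_assoc, two_pow_mul_weight, one_mul, weight, pow_succ]
  simp only [h]
  rw [ENNReal.tsum_mul_right, ENNReal.tsum_geometric, ENNReal.one_sub_inv_two, inv_inv,
    ENNReal.mul_inv_cancel two_ne_zero ENNReal.ofNat_ne_top]

/-- Every string `v` has a program of length `2 |v| + O(1)`, whatever the condition. -/
theorem exists_program {U : Machine} (hU : U.IsUniversal) :
    ∃ c : ℕ, ∀ y v, ∃ q, U.Outputs q y v ∧ q.length ≤ 2 * v.length + c := by
  have hr : Computable₂ fun (_ : List Bool) (a : ℕ × ℕ) =>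
      bif decide (a.2 < 2 ^ a.1) then some (2 * a.1 + 1, natString a.1 a.2) else none := by
    have h1 : Primrec fun a : List Bool × (ℕ × ℕ) => a.2.1 := Primrec.fst.comp Primrec.snd
    have h2 : Primrec fun a : List Bool × (ℕ × ℕ) => a.2.2 := Primrec.snd.comp Primrec.snd
    refine Primrec.to_comp (Primrec.cond
      (Primrec.nat_lt.comp h2 (primrec_pow.comp (Primrec.const 2) h1)).decide
      (Primrec.option_some.comp (Primrec.pair (Primrec.succ.comp
        (Primrec.nat_mul.comp (Primrec.const 2) h1)) (primrec_natString.comp h1 h2)))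
      (Primrec.const none))
  obtain ⟨c, hc⟩ := condK_le_of_request hU hr
  refine ⟨c + 1, fun y v => ?_⟩
  obtain ⟨j, hj, hv⟩ := exists_natString_eq v
  obtain ⟨q, hq, hlen⟩ := hc y (by
    rw [ENNReal.tsum_prod']
    refine le_trans (le_of_eq ?_) tsum_selfDelimiting_le_one
    congr! 4 with k j
    by_cases h : j < 2 ^ k <;> simp [h, reqWeight, optWeight]) (v.length, j)
      (2 * v.length + 1) v (by simp [hj, hv])
  exact ⟨q, hq, by omega⟩

theorem exists_shortest {U : Machine} (hU : U.IsUniversal) (x y : List Bool) :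
    ∃ q, U.Outputs q y x ∧ q.length = condK U x y := by
  obtain ⟨c, hc⟩ := exists_program hU
  obtain ⟨q, hq, -⟩ := hc y x
  exact Nat.sInf_mem (s := {l | ∃ p, U.Outputs p y x ∧ p.length = l}) ⟨q.length, q, hq, rfl⟩

/-- Complexity does not increase, up to a constant, if the condition is replaced by one that
computes it and the output is processed further. -/
theorem condK_le_of_transform {U : Machine} (hU : U.IsUniversal) {g : List Bool →. List Bool}
    (hg : Partrec g) {f : List Bool → List Bool →. List Bool} (hf : Partrec₂ f) :
    ∃ c : ℕ, ∀ y y' w z, y' ∈ g y → z ∈ f w y → condK U z y ≤ condK U w y' + c := by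
  obtain ⟨c, hc⟩ := hU.simulates
    (fun p y => (g y).bind fun y' => (U.eval p y').bind fun w => f w y) (by
      have h1 : Partrec fun q : List Bool × List Bool => g q.2 := hg.comp Computable.snd
      have h2 : Partrec fun q : (List Bool × List Bool) × List Bool => U.eval q.1.1 q.2 :=
        U.eval_partrec.comp (Computable.fst.comp Computable.fst) Computable.snd
      have h3 : Partrec fun q : ((List Bool × List Bool) × List Bool) × List Bool =>
          f q.2 q.1.1.2 :=
        hf.comp Computable.snd (Computable.snd.comp (Computable.fst.comp Computable.fst))
      exact Partrec.bind h1 (Partrec.bind h2 h3.to₂).to₂) (by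
    intro y p hp q hq hpq
    obtain ⟨z, hz⟩ := Part.dom_iff_mem.1 hp
    obtain ⟨z', hz'⟩ := Part.dom_iff_mem.1 hq
    simp only [Part.mem_bind_iff, U.mem_eval] at hz hz'
    obtain ⟨u, hu, w, hw, -⟩ := hz
    obtain ⟨u', hu', w', hw', -⟩ := hz'
    obtain rfl := Part.mem_unique hu hu'
    exact hU.prefixFree u p ⟨w, hw⟩ q ⟨w', hw'⟩ hpq)
  refine ⟨c, fun y y' w z hy hz => ?_⟩
  obtain ⟨p, hp, hlen⟩ := exists_shortest hU w y'
  obtain ⟨q, hq, hql⟩ := hc p y z (by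
    simp only [Part.mem_bind_iff, U.mem_eval]
    exact ⟨y', hy, w, hp, hz⟩)
  exact (condK_le hq).trans (hlen ▸ hql)

theorem condK_le_K {U : Machine} (hU : U.IsUniversal) :
    ∃ c : ℕ, ∀ x y, condK U x y ≤ K U x + c := by
  obtain ⟨c, hc⟩ := condK_le_of_transform hU (g := fun _ => Part.some []) (Computable.const [])
    (f := fun w _ => Part.some w) Computable.fst
  exact ⟨c, fun x y => hc y [] x x (Part.mem_some _) (Part.mem_some _)⟩

/-- A condition may be replaced by a program for it. -/
theorem condK_program_le {U : Machine} (hU : U.IsUniversal) :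
    ∃ c : ℕ, ∀ x y p, U.Outputs p [] y → condK U x p ≤ condK U x y + c := by
  obtain ⟨c, hc⟩ := condK_le_of_transform hU (g := fun p => U.eval p [])
    (U.eval_partrec.comp Computable.id (Computable.const []))
    (f := fun w _ => Part.some w) Computable.fst
  exact ⟨c, fun x y p h => hc p y x x ((U.mem_eval _ _ _).2 h) (Part.mem_some _)⟩

theorem K_map_le {U : Machine} (hU : U.IsUniversal) {f : List Bool → List Bool}
    (hf : Computable f) : ∃ c : ℕ, ∀ x, K U (f x) ≤ K U x + c := by
  obtain ⟨c, hc⟩ := condK_le_of_transform hU (g := fun _ => Part.some []) (Computable.const [])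
    (f := fun w _ => Part.some (f w)) (hf.comp Computable.fst)
  exact ⟨c, fun x => hc [] [] x (f x) (Part.mem_some _) (Part.mem_some _)⟩

theorem condK_map_le {U : Machine} (hU : U.IsUniversal) {f : List Bool → List Bool}
    (hf : Computable f) : ∃ c : ℕ, ∀ x y, condK U (f x) y ≤ condK U x y + c := by
  obtain ⟨c, hc⟩ := condK_le_of_transform hU (g := fun y => Part.some y) Computable.id
    (f := fun w _ => Part.some (f w)) (hf.comp Computable.fst)
  exact ⟨c, fun x y => hc y y x (f x) (Part.mem_some _) (Part.mem_some _)⟩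

/-! ### Pairs of programs -/

/-- The result of running `p` without auxiliary input for `s` steps and `q` for `t` steps with an
auxiliary input `g p w` that depends on `p` and its output `w`, where `a = ((p, s), (q, t))`. If
both runs have just halted, the programs and their outputs are returned. -/
def pairRun (U : Machine) (g : List Bool → List Bool → List Bool)
    (a : (List Bool × ℕ) × (List Bool × ℕ)) :
    Option ((List Bool × List Bool) × (List Bool × List Bool)) :=
  (U.run a.1.1 [] a.1.2).bind fun w =>
    (U.run a.2.1 (g a.1.1 w) a.2.2).map fun y => ((a.1.1, a.2.1), (w, y))

theorem pairRun_computable (U : Machine) {g : List Bool → List Bool → List Bool}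
    (hg : Computable₂ g) : Computable (pairRun U g) := by
  have h1 : Computable fun a : (List Bool × ℕ) × (List Bool × ℕ) => a.1.1 :=
    Computable.fst.comp Computable.fst
  have h2 : Computable fun a : (List Bool × ℕ) × (List Bool × ℕ) => a.2.1 :=
    Computable.fst.comp Computable.snd
  refine Computable.option_bind (U.run_computable' h1 (Computable.const [])
    (Computable.snd.comp Computable.fst)) ?_
  refine Computable.option_map (U.run_computable' (h2.comp Computable.fst)
    (hg.comp (h1.comp Computable.fst) Computable.snd)
    (Computable.snd.comp (Computable.snd.comp Computable.fst))) ?_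
  have h3 : Computable fun b : (((List Bool × ℕ) × (List Bool × ℕ)) × List Bool) × List Bool =>
      b.1.1 := Computable.fst.comp Computable.fst
  exact Computable.pair (Computable.pair (h1.comp h3) (h2.comp h3))
    (Computable.pair (Computable.snd.comp Computable.fst) Computable.snd)

theorem pairRun_eq_some_iff {U : Machine} {g : List Bool → List Bool → List Bool}
    {a : (List Bool × ℕ) × (List Bool × ℕ)} {p q w y : List Bool} :
    pairRun U g a = some ((p, q), (w, y)) ↔ a.1.1 = p ∧ a.2.1 = q ∧
      U.HaltsAt p [] a.1.2 w ∧ U.HaltsAt q (g p w) a.2.2 y := by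
  obtain ⟨⟨p', s⟩, ⟨q', t⟩⟩ := a
  simp only [pairRun, Option.bind_eq_some_iff, Option.map_eq_some_iff, Prod.mk.injEq,
    U.run_eq_some_iff]
  constructor
  · rintro ⟨w', hw', y', hy', ⟨rfl, rfl⟩, rfl, rfl⟩
    exact ⟨rfl, rfl, hw', hy'⟩
  · rintro ⟨rfl, rfl, hw, hy⟩
    exact ⟨w, hw, y, hy, ⟨rfl, rfl⟩, rfl, rfl⟩

/-- The request for the output of the second program of a pair, with the total length of the
pair. -/
def pairRequest (U : Machine) (g : List Bool → List Bool → List Bool) (_ : List Bool)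
    (a : (List Bool × ℕ) × (List Bool × ℕ)) : Option (ℕ × List Bool) :=
  (pairRun U g a).map fun b => (b.1.1.length + b.1.2.length, b.2.2)

theorem pairRequest_computable (U : Machine) {g : List Bool → List Bool → List Bool}
    (hg : Computable₂ g) : Computable₂ (pairRequest U g) := by
  refine Computable.option_map ((pairRun_computable U hg).comp Computable.snd) ?_
  refine Primrec.to_comp (Primrec.pair ?_
    (Primrec.snd.comp (Primrec.snd.comp Primrec.snd)))
  exact Primrec.nat_add.comp
    (Primrec.list_length.comp (Primrec.fst.comp (Primrec.fst.comp Primrec.snd)))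
    (Primrec.list_length.comp (Primrec.snd.comp (Primrec.fst.comp Primrec.snd)))

theorem tsum_pairRequest_le_one {U : Machine} (hU : U.IsUniversal)
    (g : List Bool → List Bool → List Bool) (y : List Bool) :
    ∑' a, reqWeight (pairRequest U g y a) ≤ 1 := by
  rw [ENNReal.tsum_prod']
  refine le_trans (ENNReal.tsum_le_tsum fun a => ?_)
    ((ENNReal.tsum_prod' (f := fun a : List Bool × ℕ => runWeight U [] a.1 a.2)).trans_le
      (tsum_runWeight_le_one hU []))
  obtain ⟨p, s⟩ := a
  cases h : U.run p [] s with
  | none => simp [pairRequest, pairRun, h, reqWeight, optWeight]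
  | some w =>
    calc ∑' b : List Bool × ℕ, reqWeight (pairRequest U g y ((p, s), b))
        = ∑' b : List Bool × ℕ, weight p.length * runWeight U (g p w) b.1 b.2 := by
          congr! 2 with b
          cases h2 : U.run b.1 (g p w) b.2 with
          | none => simp [pairRequest, pairRun, h, h2, reqWeight, optWeight, runWeight]
          | some v =>
            simp [pairRequest, pairRun, h, h2, reqWeight, optWeight, runWeight, weight_add]
      _ = weight p.length * ∑' (q : List Bool) (t : ℕ), runWeight U (g p w) q t := by
          rw [ENNReal.tsum_mul_left, ENNReal.tsum_prod']
      _ ≤ weight p.length * 1 := by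
          gcongr
          exact tsum_runWeight_le_one hU _
      _ = runWeight U [] p s := by simp [runWeight, h]

/-- Subadditivity of complexity. -/
theorem K_le_K_add_condK {U : Machine} (hU : U.IsUniversal) :
    ∃ c : ℕ, ∀ x y, K U x ≤ K U y + condK U x y + c := by
  obtain ⟨c, hc⟩ := condK_le_of_request hU
    (pairRequest_computable U (g := fun _ w => w) Computable.snd)
  refine ⟨c, fun x y => ?_⟩
  obtain ⟨p, ⟨s, hp⟩, hpl⟩ := exists_shortest hU y []
  obtain ⟨q, ⟨t, hq⟩, hql⟩ := exists_shortest hU x y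
  obtain ⟨u, hu, hlen⟩ := hc [] (tsum_pairRequest_le_one hU _ _) ((p, s), (q, t))
    (p.length + q.length) x (by
      rw [pairRequest, pairRun_eq_some_iff.2 ⟨rfl, rfl, hp, hq⟩]
      rfl)
  rw [hpl, hql] at hlen
  exact (condK_le hu).trans hlen

/-! ### Symmetry of information -/

/-- The `i`-th pair of programs `(u, q)` with outputs `(x, y)`, where `U (u) = x` and
`U (q, u) = y`. -/
def programPair (U : Machine) (i : ℕ) :
    Option ((List Bool × List Bool) × (List Bool × List Bool)) :=
  (Encodable.decode₂ ((List Bool × ℕ) × (List Bool × ℕ)) i).bind (pairRun U fun u _ => u)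

/-- The request of `|u| + |q|` bits for `y`, where `(u, q)` is the `i`-th pair of programs. -/
def programPairRequest (U : Machine) (i : ℕ) : Option (ℕ × List Bool) :=
  (programPair U i).map fun b => (b.1.1.length + b.1.2.length, b.2.2)

theorem programPair_computable (U : Machine) : Computable (programPair U) :=
  Computable.option_bind Primrec.decode₂.to_comp
    ((pairRun_computable U (g := fun u _ => u) Computable.fst).comp Computable.snd).to₂

theorem programPair_spec {U : Machine} {i : ℕ} {u q x y : List Bool}
    (h : programPair U i = some ((u, q), (x, y))) : U.Outputs u [] x ∧ U.Outputs q u y := by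
  unfold programPair at h
  rw [Option.bind_eq_some_iff] at h
  obtain ⟨a, -, ha⟩ := h
  obtain ⟨-, -, h1, h2⟩ := pairRun_eq_some_iff.1 ha
  exact ⟨⟨_, h1⟩, ⟨_, h2⟩⟩

theorem exists_programPair {U : Machine} {u q x y : List Bool} (hu : U.Outputs u [] x)
    (hq : U.Outputs q u y) : ∃ i, programPair U i = some ((u, q), (x, y)) := by
  obtain ⟨s, hs⟩ := hu
  obtain ⟨t, ht⟩ := hq
  refine ⟨Encodable.encode ((u, s), (q, t)), ?_⟩
  simp only [programPair, Encodable.decode₂_encode, Option.bind_some]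
  exact pairRun_eq_some_iff.2 ⟨rfl, rfl, hs, ht⟩

theorem programPairRequest_eq (U : Machine) (y : List Bool) (i : ℕ) :
    programPairRequest U i = natRequests (pairRequest U fun u _ => u) y i := by
  rw [programPairRequest, programPair, Option.map_bind]
  rfl

theorem programPairRequest_computable (U : Machine) : Computable (programPairRequest U) :=
  ((natRequests_computable (pairRequest_computable U (g := fun u _ => u) Computable.fst)).comp
    (Computable.const []) Computable.id).of_eq fun i => (programPairRequest_eq U [] i).symm

/-- The pairs of programs for `y` have total weight `O(2 ^ (-K(y)))`. -/
theorem programPair_coding {U : Machine} (hU : U.IsUniversal) :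
    ∃ c : ℕ, ∀ y, ∑' i, optWeight (lengthFor y (programPairRequest U i))
      ≤ 2 ^ c * weight (K U y) := by
  obtain ⟨c, hc⟩ := coding_theorem_nat hU (r := fun _ i => programPairRequest U i)
    ((programPairRequest_computable U).comp Computable.snd).to₂
  refine ⟨c, fun y => hc [] ?_ y⟩
  simp only [programPairRequest_eq U []]
  rw [tsum_natRequests _ _ reqWeight rfl]
  exact tsum_pairRequest_le_one hU _ _

/-- The test whether the pairs of programs for `y` that come up to the `i`-th one have total weight
at most `2 ^ (c - j)`. If `c` is the constant of the coding theorem then all `i` pass for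
`j = K(y)`. -/
def massTest (U : Machine) (c : ℕ) (y : List Bool) (j i : ℕ) : Bool :=
  decide ((massFor (programPairRequest U) y (i + 1)).1 * 2 ^ j ≤
    2 ^ (c + (massFor (programPairRequest U) y (i + 1)).2))

theorem massTest_iff {U : Machine} {c : ℕ} {y : List Bool} {j i : ℕ} : massTest U c y j i = true ↔
    ∑ k ∈ Finset.range (i + 1), optWeight (lengthFor y (programPairRequest U k))
      ≤ 2 ^ c * weight j := by
  rw [massTest, decide_eq_true_eq]
  exact partialSum_le_iff _ _ _ _

theorem massTest_computable (U : Machine) (c : ℕ) {α : Type*} [Primcodable α]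
    {y : α → List Bool} {j i : α → ℕ} (hy : Computable y) (hj : Computable j)
    (hi : Computable i) : Computable fun a => massTest U c (y a) (j a) (i a) := by
  have h1 := massFor_computable (r := fun _ : α => programPairRequest U)
    ((programPairRequest_computable U).comp Computable.snd).to₂ hy (Computable.succ.comp hi)
  have h2 : Primrec₂ fun (s : ℕ × ℕ) (j : ℕ) => decide (s.1 * 2 ^ j ≤ 2 ^ (c + s.2)) :=
    (Primrec.nat_le.comp (Primrec.nat_mul.comp (Primrec.fst.comp Primrec.fst)
      (primrec_pow.comp (Primrec.const 2) Primrec.snd))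
      (primrec_pow.comp (Primrec.const 2) (Primrec.nat_add.comp (Primrec.const c)
        (Primrec.snd.comp Primrec.fst)))).decide
  exact h2.to_comp.comp h1 hj

theorem massTest_K {U : Machine} {c : ℕ} {y : List Bool}
    (hc : ∑' i, optWeight (lengthFor y (programPairRequest U i)) ≤ 2 ^ c * weight (K U y))
    (i : ℕ) : massTest U c y (K U y) i = true :=
  massTest_iff.2 ((ENNReal.sum_le_tsum _).trans hc)

/-- The terms of a series up to which the partial sums are at most `B` sum up to at most `B`. -/
theorem tsum_ite_sum_le (m : ℕ → ℝ≥0∞) (B : ℝ≥0∞) :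
    ∑' i, (if ∑ k ∈ Finset.range (i + 1), m k ≤ B then m i else 0) ≤ B := by
  rw [ENNReal.tsum_eq_iSup_nat]
  refine iSup_le fun N => ?_
  induction N with
  | zero => simp
  | succ N ih =>
    rw [Finset.sum_range_succ]
    split_ifs with h
    · refine le_trans ?_ h
      rw [Finset.sum_range_succ]
      gcongr
      split_ifs <;> simp
    · simpa using ih

theorem tsum_massTest_le (U : Machine) (c : ℕ) (y : List Bool) (j : ℕ) :
    ∑' i, (if massTest U c y j i then optWeight (lengthFor y (programPairRequest U i)) else 0)
      ≤ 2 ^ c * weight j := by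
  simp only [massTest_iff]
  exact tsum_ite_sum_le (fun i => optWeight (lengthFor y (programPairRequest U i))) _

theorem optWeight_lengthFor_programPair {U : Machine} {i : ℕ} {u q x y : List Bool}
    (h : programPair U i = some ((u, q), (x, y))) :
    optWeight (lengthFor y (programPairRequest U i)) = weight (u.length + q.length) := by
  rw [lengthFor_eq_some_iff.2 (show programPairRequest U i = some (u.length + q.length, y) by
    simp [programPairRequest, h])]
  rfl

/-- The triples of programs `(u, q, s)` such that `(u, q)` is the `i`-th pair of programs,
`U (u) = x`, `U (q, u) = y`, the program `s` outputs `y` after exactly `t` steps, and the pairs for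
`y` up to the `i`-th one have total weight at most `2 ^ (c - |s|)`. -/
def programTriple (U : Machine) (c : ℕ) (a : ℕ × (List Bool × ℕ)) :
    Option ((List Bool × List Bool) × (List Bool × List Bool)) :=
  (programPair U a.1).bind fun b =>
    bif decide (U.run a.2.1 [] a.2.2 = some b.2.2) && massTest U c b.2.2 a.2.1.length a.1
    then some b else none

theorem programTriple_computable (U : Machine) (c : ℕ) : Computable (programTriple U c) := by
  refine Computable.option_bind ((programPair_computable U).comp Computable.fst) ?_
  have hs : Computable fun q : (ℕ × (List Bool × ℕ)) ×
      ((List Bool × List Bool) × (List Bool × List Bool)) => q.1.2.1 :=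
    Computable.fst.comp (Computable.snd.comp Computable.fst)
  have hy : Computable fun q : (ℕ × (List Bool × ℕ)) ×
      ((List Bool × List Bool) × (List Bool × List Bool)) => q.2.2.2 :=
    Computable.snd.comp (Computable.snd.comp Computable.snd)
  refine Computable.cond (Primrec.and.to_comp.comp
    ((Primrec.eq (α := Option (List Bool))).decide.to_comp.comp
      (U.run_computable' hs (Computable.const [])
        (Computable.snd.comp (Computable.snd.comp Computable.fst)))
      (Computable.option_some.comp hy))
    (massTest_computable U c hy (Computable.list_length.comp hs)
      (Computable.fst.comp Computable.fst)))
    (Computable.option_some.comp Computable.snd) (Computable.const none)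

theorem programTriple_eq_some_iff {U : Machine} {c : ℕ} {a : ℕ × (List Bool × ℕ)}
    {u q x y : List Bool} : programTriple U c a = some ((u, q), (x, y)) ↔
      programPair U a.1 = some ((u, q), (x, y)) ∧ U.run a.2.1 [] a.2.2 = some y ∧
        massTest U c y a.2.1.length a.1 = true := by
  unfold programTriple
  rcases h : programPair U a.1 with _ | ⟨⟨u', q'⟩, ⟨x', y'⟩⟩
  · simp
  · simp only [Option.bind_some, Bool.cond_eq_ite, Bool.and_eq_true, decide_eq_true_eq]
    constructor
    · intro hh
      split_ifs at hh with hc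
      simp only [Option.some.injEq, Prod.mk.injEq] at hh
      obtain ⟨⟨rfl, rfl⟩, rfl, rfl⟩ := hh
      exact ⟨rfl, hc⟩
    · rintro ⟨h1, h2⟩
      simp only [Option.some.injEq, Prod.mk.injEq] at h1
      obtain ⟨⟨rfl, rfl⟩, rfl, rfl⟩ := h1
      rw [if_pos h2]

/-- The request of `|u| + |q| + c` bits for `x` that belongs to a triple `(u, q, s)`. -/
def tripleRequest (U : Machine) (c : ℕ) (_ : List Bool) (a : ℕ × (List Bool × ℕ)) :
    Option (ℕ × List Bool) :=
  (programTriple U c a).map fun b => (b.1.1.length + b.1.2.length + c, b.2.1)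

theorem tripleRequest_computable (U : Machine) (c : ℕ) : Computable₂ (tripleRequest U c) := by
  refine Computable.option_map ((programTriple_computable U c).comp Computable.snd) ?_
  refine Primrec.to_comp (Primrec.pair (Primrec.nat_add.comp ?_ (Primrec.const c))
    (Primrec.fst.comp (Primrec.snd.comp Primrec.snd)))
  exact Primrec.nat_add.comp
    (Primrec.list_length.comp (Primrec.fst.comp (Primrec.fst.comp Primrec.snd)))
    (Primrec.list_length.comp (Primrec.snd.comp (Primrec.fst.comp Primrec.snd)))

/-- For each program `s` with output `y`, the triples that contain `s` have total weight at most
`2 ^ (-|s|)`, because of the mass test. -/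
theorem tsum_tripleRequest_le_one {U : Machine} (hU : U.IsUniversal) (c : ℕ) (z : List Bool) :
    ∑' a, reqWeight (tripleRequest U c z a) ≤ 1 := by
  rw [ENNReal.tsum_prod', ENNReal.tsum_comm]
  refine le_trans (ENNReal.tsum_le_tsum fun a => ?_)
    ((ENNReal.tsum_prod' (f := fun a : List Bool × ℕ => runWeight U [] a.1 a.2)).trans_le
      (tsum_runWeight_le_one hU []))
  obtain ⟨s, t⟩ := a
  cases h : U.run s [] t with
  | none =>
    have : ∀ i, programTriple U c (i, (s, t)) = none := by
      intro i
      by_contra hne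
      obtain ⟨⟨⟨u, q⟩, x, y⟩, hb⟩ := Option.ne_none_iff_exists'.1 hne
      have := (programTriple_eq_some_iff.1 hb).2.1
      simp [h] at this
    simp [tripleRequest, this, reqWeight, optWeight]
  | some y =>
    have key : ∀ i, reqWeight (tripleRequest U c z (i, (s, t))) ≤
        (if massTest U c y s.length i then optWeight (lengthFor y (programPairRequest U i))
          else 0) * weight c := by
      intro i
      rcases hb : programTriple U c (i, (s, t)) with _ | ⟨⟨u, q⟩, x, y'⟩
      · simp [tripleRequest, hb, reqWeight, optWeight]
      · obtain ⟨h1, h2, h3⟩ := programTriple_eq_some_iff.1 hb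
        obtain rfl : y = y' := by simpa [h] using h2
        rw [if_pos h3, optWeight_lengthFor_programPair h1, ← weight_add]
        simp [tripleRequest, hb, reqWeight, optWeight]
    refine (ENNReal.tsum_le_tsum key).trans ?_
    rw [ENNReal.tsum_mul_right, mul_weight_le_iff]
    refine (tsum_massTest_le U c y s.length).trans (le_of_eq ?_)
    simp [runWeight, h, mul_comm]

/-- The request, in condition `u₀`, of `|q| + c + d` bits for the pair `(|s|, y)` that belongs to a
triple `(u₀, q, s)`. -/
def lengthRequest (U : Machine) (c d : ℕ) (u₀ : List Bool) (a : ℕ × (List Bool × ℕ)) :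
    Option (ℕ × List Bool) :=
  (programTriple U c a).bind fun b => bif decide (b.1.1 = u₀)
    then some (b.1.2.length + c + d, code (a.2.1.length, b.2.2)) else none

theorem lengthRequest_computable (U : Machine) (c d : ℕ) :
    Computable₂ (lengthRequest U c d) := by
  refine Computable.option_bind ((programTriple_computable U c).comp Computable.snd) ?_
  have hb : Primrec fun q : (List Bool × (ℕ × (List Bool × ℕ))) ×
      ((List Bool × List Bool) × (List Bool × List Bool)) => q.2 := Primrec.snd
  refine Primrec.to_comp (Primrec.cond
    (Primrec.eq.comp (Primrec.fst.comp (Primrec.fst.comp hb)) (Primrec.fst.comp Primrec.fst)).decide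
    (Primrec.option_some.comp (Primrec.pair (Primrec.nat_add.comp (Primrec.nat_add.comp
      (Primrec.list_length.comp (Primrec.snd.comp (Primrec.fst.comp hb))) (Primrec.const c))
      (Primrec.const d)) (primrec_code.comp (Primrec.pair (Primrec.list_length.comp
        (Primrec.fst.comp (Primrec.snd.comp (Primrec.snd.comp Primrec.fst))))
        (Primrec.snd.comp (Primrec.snd.comp hb)))))) (Primrec.const none))

/-- The requests in condition `u₀` are those for `U (u₀)` among the triples, scaled by
`2 ^ (|u₀| - d)`. -/
theorem reqWeight_lengthRequest_le {U : Machine} {c d : ℕ} {u₀ x : List Bool}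
    (hu : U.Outputs u₀ [] x) (z : List Bool) (a : ℕ × (List Bool × ℕ)) :
    reqWeight (lengthRequest U c d u₀ a) ≤
      2 ^ u₀.length * weight d * optWeight (lengthFor x (tripleRequest U c z a)) := by
  rcases hb : programTriple U c a with _ | ⟨⟨u, q⟩, x', y⟩
  · simp [lengthRequest, hb, reqWeight, optWeight]
  · by_cases h : u = u₀
    · subst h
      obtain rfl := hu.unique (programPair_spec (programTriple_eq_some_iff.1 hb).1).1
      rw [lengthFor_eq_some_iff.2 (show tripleRequest U c z a
        = some (u.length + q.length + c, x) by simp [tripleRequest, hb])]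
      simp only [lengthRequest, hb, reqWeight, optWeight, Option.bind_some, decide_true, cond_true,
        Option.map_some]
      rw [add_assoc u.length, weight_add u.length, mul_right_comm, ← mul_assoc,
        two_pow_mul_weight, one_mul, weight_add (q.length + c)]
    · simp [lengthRequest, hb, reqWeight, optWeight, h]

/-- Given a shortest program for `x`, the complexity of a string `y` comes for free with `y`. -/
theorem condK_K_pair_le {U : Machine} (hU : U.IsUniversal) :
    ∃ c : ℕ, ∀ x y u, U.Outputs u [] x → u.length = K U x →
      condK U (code (K U y, y)) u ≤ condK U y u + c := by
  obtain ⟨c, hc⟩ := programPair_coding hU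
  obtain ⟨d, hd⟩ := coding_theorem hU (tripleRequest_computable U c)
  obtain ⟨b, hb⟩ := condK_le_of_request hU (lengthRequest_computable U c d)
  refine ⟨c + d + b, fun x y u hu hul => ?_⟩
  obtain ⟨q, hq, hql⟩ := exists_shortest hU y u
  obtain ⟨s, ⟨t, hs⟩, hsl⟩ := exists_shortest hU y []
  obtain ⟨i, hi⟩ := exists_programPair hu hq
  have htriple : programTriple U c (i, (s, t)) = some ((u, q), (x, y)) :=
    programTriple_eq_some_iff.2 ⟨hi, (U.run_eq_some_iff _ _ _ _).2 hs,
      by rw [hsl]; exact massTest_K (hc y) i⟩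
  have hsum : ∑' a, reqWeight (lengthRequest U c d u a) ≤ 1 := by
    refine (ENNReal.tsum_le_tsum (reqWeight_lengthRequest_le hu [])).trans ?_
    rw [ENNReal.tsum_mul_left]
    calc 2 ^ u.length * weight d * ∑' a, optWeight (lengthFor x (tripleRequest U c [] a))
        ≤ 2 ^ u.length * weight d * (2 ^ d * weight (condK U x [])) := by
          gcongr
          exact hd [] (tsum_tripleRequest_le_one hU c []) x
      _ = (2 ^ u.length * weight u.length) * (2 ^ d * weight d) := by
          rw [hul, K]; ring
      _ = 1 := by rw [two_pow_mul_weight, two_pow_mul_weight, one_mul]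
  obtain ⟨p, hp, hlen⟩ := hb u hsum (i, (s, t)) (q.length + c + d) (code (K U y, y)) (by
    simp only [lengthRequest, htriple, Option.bind_some, decide_true, cond_true, hsl]
    rfl)
  have := condK_le hp
  omega

/-- The request, in condition `y`, of `|u| + |q| + c + 2 k + 1 - j` bits for `x`, where `(u, q)` is
the `i`-th pair of programs, with outputs `(x, y)`, where `j < 2 ^ k`, and where the pairs for `y`
up to the `i`-th one have total weight at most `2 ^ (c - j)`. -/
def conditionalRequest (U : Machine) (c : ℕ) (y : List Bool) (a : ℕ × (ℕ × ℕ)) :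
    Option (ℕ × List Bool) :=
  (programPair U a.1).bind fun b =>
    bif (decide (b.2.2 = y) && decide (a.2.2 < 2 ^ a.2.1)) && massTest U c y a.2.2 a.1
    then some (b.1.1.length + b.1.2.length + c + (2 * a.2.1 + 1) - a.2.2, b.2.1) else none

theorem conditionalRequest_computable (U : Machine) (c : ℕ) :
    Computable₂ (conditionalRequest U c) := by
  refine Computable.option_bind ((programPair_computable U).comp
    (Computable.fst.comp Computable.snd)) ?_
  have hb : Primrec fun q : (List Bool × (ℕ × (ℕ × ℕ))) ×
      ((List Bool × List Bool) × (List Bool × List Bool)) => q.2 := Primrec.snd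
  have hy : Primrec fun q : (List Bool × (ℕ × (ℕ × ℕ))) ×
      ((List Bool × List Bool) × (List Bool × List Bool)) => q.1.1 :=
    Primrec.fst.comp Primrec.fst
  have hi : Primrec fun q : (List Bool × (ℕ × (ℕ × ℕ))) ×
      ((List Bool × List Bool) × (List Bool × List Bool)) => q.1.2.1 :=
    Primrec.fst.comp (Primrec.snd.comp Primrec.fst)
  have hk : Primrec fun q : (List Bool × (ℕ × (ℕ × ℕ))) ×
      ((List Bool × List Bool) × (List Bool × List Bool)) => q.1.2.2.1 :=
    Primrec.fst.comp (Primrec.snd.comp (Primrec.snd.comp Primrec.fst))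
  have hj : Primrec fun q : (List Bool × (ℕ × (ℕ × ℕ))) ×
      ((List Bool × List Bool) × (List Bool × List Bool)) => q.1.2.2.2 :=
    Primrec.snd.comp (Primrec.snd.comp (Primrec.snd.comp Primrec.fst))
  refine Computable.cond (Primrec.and.to_comp.comp (Primrec.to_comp (Primrec.and.comp
    (Primrec.eq.comp (Primrec.snd.comp (Primrec.snd.comp hb)) hy).decide
    (Primrec.nat_lt.comp hj (primrec_pow.comp (Primrec.const 2) hk)).decide))
    (massTest_computable U c hy.to_comp hj.to_comp hi.to_comp)) ?_ (Computable.const none)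
  exact Primrec.to_comp (Primrec.option_some.comp (Primrec.pair (Primrec.nat_sub.comp
    (Primrec.nat_add.comp (Primrec.nat_add.comp (Primrec.nat_add.comp
      (Primrec.list_length.comp (Primrec.fst.comp (Primrec.fst.comp hb)))
      (Primrec.list_length.comp (Primrec.snd.comp (Primrec.fst.comp hb)))) (Primrec.const c))
      (Primrec.succ.comp (Primrec.nat_mul.comp (Primrec.const 2) hk))) hj)
    (Primrec.fst.comp (Primrec.snd.comp hb))))

theorem weight_sub_le (n j : ℕ) : weight (n - j) ≤ weight n * 2 ^ j := by
  rw [← mul_weight_le_iff, ← weight_add, weight_le_weight_iff]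
  omega

theorem reqWeight_conditionalRequest_le (U : Machine) (c : ℕ) (y : List Bool) (i k j : ℕ) :
    reqWeight (conditionalRequest U c y (i, (k, j))) ≤
      (if massTest U c y j i then optWeight (lengthFor y (programPairRequest U i)) else 0) *
        (weight c * 2 ^ j * (if j < 2 ^ k then weight (2 * k + 1) else 0)) := by
  rcases hb : programPair U i with _ | ⟨⟨u, q⟩, x, y'⟩
  · simp [conditionalRequest, hb, reqWeight, optWeight]
  · by_cases h : (y' = y ∧ j < 2 ^ k) ∧ massTest U c y j i = true
    · obtain ⟨⟨rfl, hj⟩, ht⟩ := h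
      rw [if_pos ht, if_pos hj, optWeight_lengthFor_programPair hb]
      simp only [conditionalRequest, hb, Option.bind_some, decide_true, hj, ht, Bool.and_true,
        cond_true, reqWeight, Option.map_some, optWeight]
      refine (weight_sub_le _ _).trans (le_of_eq ?_)
      rw [weight_add, weight_add]
      ring
    · have : conditionalRequest U c y (i, (k, j)) = none := by
        simp only [conditionalRequest, hb, Option.bind_some, Bool.cond_eq_ite, Bool.and_eq_true,
          decide_eq_true_eq, if_neg h]
      simp [this, reqWeight, optWeight]

/-- The requests for a fixed guess `j` of `K(y)` with `k` digits have total weight at most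
`2 ^ (-2 k - 1)`, because of the mass test. -/
theorem tsum_conditionalRequest_le_one (U : Machine) (c : ℕ) (y : List Bool) :
    ∑' a, reqWeight (conditionalRequest U c y a) ≤ 1 := by
  rw [ENNReal.tsum_prod', ENNReal.tsum_comm, ENNReal.tsum_prod']
  refine le_trans (ENNReal.tsum_le_tsum fun k => ENNReal.tsum_le_tsum fun j => ?_)
    tsum_selfDelimiting_le_one
  refine (ENNReal.tsum_le_tsum fun i => reqWeight_conditionalRequest_le U c y i k j).trans ?_
  rw [ENNReal.tsum_mul_right]
  refine (mul_le_mul_left (tsum_massTest_le U c y j) _).trans (le_of_eq ?_)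
  calc 2 ^ c * weight j * (weight c * 2 ^ j * (if j < 2 ^ k then weight (2 * k + 1) else 0))
      = (2 ^ c * weight c) * (2 ^ j * weight j) *
          (if j < 2 ^ k then weight (2 * k + 1) else 0) := by ring
    _ = _ := by rw [two_pow_mul_weight, two_pow_mul_weight, one_mul, one_mul]

/-- Symmetry of information, with a logarithmic error term because the condition of `K(x | y)` is
`y` and not a shortest program for it. -/
theorem K_add_condK_le {U : Machine} (hU : U.IsUniversal) :
    ∃ c : ℕ, ∀ x y u, U.Outputs u [] x → u.length = K U x →
      K U y + condK U x y ≤ K U x + condK U y u + 2 * (K U y).size + c := by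
  obtain ⟨c, hc⟩ := programPair_coding hU
  obtain ⟨b, hb⟩ := condK_le_of_request hU (conditionalRequest_computable U c)
  refine ⟨c + 1 + b, fun x y u hu hul => ?_⟩
  obtain ⟨q, hq, hql⟩ := exists_shortest hU y u
  obtain ⟨i, hi⟩ := exists_programPair hu hq
  obtain ⟨p, hp, hlen⟩ := hb y (tsum_conditionalRequest_le_one U c y)
    (i, ((K U y).size, K U y)) (u.length + q.length + c + (2 * (K U y).size + 1) - K U y) x (by
      have h1 : K U y < 2 ^ (K U y).size := Nat.lt_size_self _
      simp only [conditionalRequest, hi, Option.bind_some, decide_true, h1, massTest_K (hc y) i,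
        Bool.and_true, cond_true])
  -- a single pair has no more than the total weight of all pairs, so that the subtraction in the
  -- length of the request does not truncate
  have hle : K U y ≤ u.length + q.length + c := by
    rw [← weight_le_weight_iff, weight_add, mul_weight_le_iff, mul_comm]
    refine le_trans ?_ (hc y)
    rw [← optWeight_lengthFor_programPair hi]
    exact ENNReal.le_tsum i
  have := condK_le hp
  omega

/-! ### First programs and witnesses -/

theorem exists_isFirst (U : Machine) {P : Set (List Bool)} {k : ℕ} (hP : ∀ p ∈ P, p.length = k)
    (hne : P.Nonempty) : ∃ p, IsFirst U P p := by
  have hfin : P.Finite := (List.finite_length_eq Bool k).subset hP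
  obtain ⟨p, hp, hmin⟩ := Set.exists_min_image P (fun p => toLex (U.rt p [], p)) hfin hne
  refine ⟨p, hp, fun q hq => ?_⟩
  simpa [Prod.Lex.toLex_le_toLex] using hmin q hq

theorem star_spec {U : Machine} (hU : U.IsUniversal) (x : List Bool) :
    U.Outputs (star U x) [] x ∧ (star U x).length = K U x :=
  (Classical.epsilon_spec (exists_isFirst U (fun _ hp => hp.2) (exists_shortest hU x []))).1

theorem setK_le {U : Machine} {p : List Bool} {S : Finset (List Bool)}
    (h : U.Outputs p [] (setCode S)) : setK U S ≤ p.length :=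
  condK_le h

theorem exists_logCard_eq_structureFn {U : Machine} {x : List Bool} {α : ℕ}
    (h : minLevel U x ≤ α) : ∃ S, x ∈ S ∧ setK U S ≤ α ∧ logCard S = structureFn U x α := by
  obtain ⟨S, hx, hS⟩ := Nat.sInf_mem (s := {α | ∃ S : Finset (List Bool), x ∈ S ∧ setK U S ≤ α})
    ⟨setK U {x}, {x}, by simp, le_rfl⟩
  exact Nat.sInf_mem (s := {m | ∃ S : Finset (List Bool), x ∈ S ∧ setK U S ≤ α ∧ logCard S = m})
    ⟨logCard S, S, hx, hS.trans h, rfl⟩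

theorem structureFn_le {U : Machine} {x : List Bool} {α : ℕ} {S : Finset (List Bool)}
    (hx : x ∈ S) (h : setK U S ≤ α) : structureFn U x α ≤ logCard S :=
  Nat.sInf_le ⟨S, hx, h, rfl⟩

theorem minLevel_le {U : Machine} {x : List Bool} {S : Finset (List Bool)} (hx : x ∈ S) :
    minLevel U x ≤ setK U S :=
  Nat.sInf_le ⟨S, hx, le_rfl⟩

/-! ### The levels of the minimal partial models -/

/-- The invariants of the recursion for `k_α`. The last clause says that `k_α + h_x(k_α)` exceeds
`α + h_x(α)` by less than the threshold. -/
theorem dropLevel_spec (U : Machine) (e : List Bool → ℕ → ℕ) (x : List Bool) (α : ℕ) :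
    minLevel U x ≤ dropLevel U e x α ∧
    (α ≤ minLevel U x → dropLevel U e x α = minLevel U x) ∧
    (minLevel U x ≤ α → dropLevel U e x α ≤ α) ∧
    (dropLevel U e x α < α → dropLevel U e x α + structureFn U x (dropLevel U e x α) <
      α + structureFn U x α + threshold U e x (dropLevel U e x α)) := by
  induction α with
  | zero => exact ⟨le_rfl, fun _ => rfl, fun h => h, fun h => absurd h (Nat.not_lt_zero _)⟩
  | succ α ih =>
    obtain ⟨h1, h2, h3, -⟩ := ih
    rw [dropLevel]
    split_ifs with hc
    · exact ⟨by omega, fun h => by omega, fun _ => le_rfl, fun h => by omega⟩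
    · refine ⟨h1, fun h => h2 (by omega), fun h => ?_, fun h => ?_⟩
      · rcases Nat.le_or_eq_of_le_succ h with h | h
        · exact (h3 h).trans (Nat.le_succ _)
        · rw [h2 (by omega), h]
      · by_contra hn
        exact hc ⟨by omega, by omega⟩

/-- The structure function decreases strictly at each level where a drop occurs. -/
theorem dropLevel_drop (U : Machine) (e : List Bool → ℕ → ℕ) (x : List Bool) (α : ℕ) :
    dropLevel U e x (dropLevel U e x α) = dropLevel U e x α ∧
    (dropLevel U e x α = minLevel U x ∨ ∃ β, dropLevel U e x α = β + 1 ∧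
      structureFn U x (β + 1) < structureFn U x β) := by
  induction α with
  | zero => exact ⟨(dropLevel_spec U e x _).2.1 le_rfl, Or.inl rfl⟩
  | succ α ih =>
    by_cases hc : minLevel U x ≤ α ∧ (α + 1) + structureFn U x (α + 1) +
      threshold U e x (dropLevel U e x α) ≤ dropLevel U e x α + structureFn U x (dropLevel U e x α)
    · have hd : dropLevel U e x (α + 1) = α + 1 := by
        rw [dropLevel]
        exact if_pos hc
      rw [hd, hd]
      refine ⟨rfl, Or.inr ⟨α, rfl, ?_⟩⟩
      obtain ⟨-, -, h3, h4⟩ := dropLevel_spec U e x α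
      rcases (h3 hc.1).lt_or_eq with h | h
      · have := h4 h
        omega
      · rw [h] at hc
        omega
    · have hd : dropLevel U e x (α + 1) = dropLevel U e x α := by
        rw [dropLevel]
        exact if_neg hc
      rwa [hd]

/-- A minimal partial model is the witness at the level that equals its complexity, and its
log-cardinality is the value of the structure function. It is not dominated by any other model, in
the sense that a simpler model has a larger log-cardinality. -/
theorem minimalPartialModels_spec {U : Machine} (hU : U.IsUniversal) {e : List Bool → ℕ → ℕ}
    {c d : ℕ} {x : List Bool} {S : Finset (List Bool)} (hS : S ∈ minimalPartialModels U e c d x) :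
    (∃ p, IsFirst U {q | q.length = setK U S ∧ ∃ S', OutputsOptimal U x (setK U S) q S'} p ∧
      U.Outputs p [] (setCode S)) ∧ x ∈ S ∧ logCard S = structureFn U x (setK U S) ∧
    ∀ T, x ∈ T → setK U S ≤ setK U T ∨ logCard S < logCard T := by
  obtain ⟨α, -, -, rfl⟩ := hS
  obtain ⟨hfix, hdrop⟩ := dropLevel_drop U e x α
  have hmin := (dropLevel_spec U e x α).1
  set k := dropLevel U e x α
  have hmodel : modelAt U e c x k = witness U x k := by
    rw [modelAt]
    simp [hfix]
  rw [hmodel]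
  have hpareto : ∀ T, x ∈ T → k ≤ setK U T ∨ structureFn U x k < logCard T := by
    intro T hT
    rcases hdrop with h | ⟨β, hβ, hlt⟩
    · exact Or.inl (h ▸ minLevel_le hT)
    · rcases le_or_gt k (setK U T) with h | h
      · exact Or.inl h
      · right
        rw [hβ] at h ⊢
        exact hlt.trans_le (structureFn_le hT (Nat.lt_succ_iff.1 h))
  obtain ⟨T, hxT, hT, hTl⟩ := exists_logCard_eq_structureFn hmin
  -- a set of least log-cardinality at level `k` has complexity exactly `k`, so that some program of
  -- length exactly `k` outputs it and the witness exists
  have hTk : setK U T = k := by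
    rcases hpareto T hxT with h | h <;> omega
  obtain ⟨q, hq, hql⟩ := exists_shortest hU (setCode T) []
  obtain ⟨p, hp⟩ := exists_isFirst U
    (P := {q | q.length = k ∧ ∃ S', OutputsOptimal U x k q S'}) (fun _ h => h.1)
    ⟨q, hql.trans hTk, T, hq, hxT, hTl.le⟩
  obtain ⟨p, hp, hout, hx, hl⟩ : ∃ p,
      IsFirst U {q | q.length = k ∧ ∃ S', OutputsOptimal U x k q S'} p ∧
        OutputsOptimal U x k p (witness U x k) := by
    obtain ⟨S', hS'⟩ := hp.1.2
    exact Classical.epsilon_spec (p := fun S => ∃ p,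
      IsFirst U {q | q.length = k ∧ ∃ S', OutputsOptimal U x k q S'} p ∧ OutputsOptimal U x k p S)
      ⟨S', p, hp, hS'⟩
  have hle : setK U (witness U x k) ≤ k := (setK_le hout).trans hp.1.1.le
  have hk : setK U (witness U x k) = k := by
    rcases hpareto _ hx with h | h <;> omega
  have hlog : logCard (witness U x k) = structureFn U x k := le_antisymm hl (structureFn_le hx hle)
  rw [hk, hlog]
  exact ⟨⟨p, hp, hout⟩, hx, rfl, hpareto⟩

/-! ### Computing a witness from its complexity and its log-cardinality -/

/-- The unbounded search `Nat.rfindOpt` returns the first value that is defined. -/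
theorem mem_rfindOpt_of_first {α : Type*} {f : ℕ → Option α} {n : ℕ} {a : α} (h : f n = some a)
    (hlt : ∀ m < n, f m = none) : a ∈ Nat.rfindOpt f := by
  rw [Nat.rfindOpt, Part.mem_bind_iff]
  refine ⟨n, Nat.mem_rfind.2 ⟨by simp [h], fun {m} hm => by simp [hlt m hm]⟩, by simp [h]⟩

/-- For `N = t * 2 ^ k + j` with `j < 2 ^ k`, the output of the `j`-th program of length `k` if it
halts after exactly `t` steps and outputs the code of a model of `x` of log-cardinality at most
`l`. Larger `N` thus correspond to programs that come later. -/
noncomputable def modelSearchStep (U : Machine) (x : List Bool) (a : ℕ × ℕ) (N : ℕ) :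
    Option (List Bool) :=
  open Classical in
  (U.run (natString a.1 (N % 2 ^ a.1)) [] (N / 2 ^ a.1)).bind fun y =>
    bif decide (IsModelCode x a.2 y) then some y else none

theorem modelSearchStep_eq_some_iff {U : Machine} {x : List Bool} {a : ℕ × ℕ} {N : ℕ}
    {y : List Bool} : modelSearchStep U x a N = some y ↔
      U.HaltsAt (natString a.1 (N % 2 ^ a.1)) [] (N / 2 ^ a.1) y ∧ IsModelCode x a.2 y := by
  simp only [modelSearchStep, Option.bind_eq_some_iff, Bool.cond_eq_ite, decide_eq_true_eq,
    U.run_eq_some_iff]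
  constructor
  · rintro ⟨z, hz, h⟩
    split_ifs at h with hm
    obtain rfl : z = y := by simpa using h
    exact ⟨hz, by simpa using hm⟩
  · rintro ⟨h1, h2⟩
    exact ⟨y, h1, by simp [h2]⟩

/-- The output of the first program of length `k` that outputs the code of a model of `x` of
log-cardinality at most `l`, where `w` is the code of `(k, l)`. -/
noncomputable def modelSearch (U : Machine) (w x : List Bool) : Part (List Bool) :=
  (uncode (ℕ × ℕ) w : Part (ℕ × ℕ)).bind fun a => Nat.rfindOpt (modelSearchStep U x a)

theorem modelSearch_partrec (U : Machine) : Partrec₂ (modelSearch U) := by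
  refine Partrec.bind (Computable.ofOption (primrec_uncode.to_comp.comp Computable.fst)) ?_
  refine Partrec.rfindOpt ?_
  have hk : Primrec fun q : ((List Bool × List Bool) × (ℕ × ℕ)) × ℕ => 2 ^ q.1.2.1 :=
    primrec_pow.comp (Primrec.const 2) (Primrec.fst.comp (Primrec.snd.comp Primrec.fst))
  refine Computable.option_bind (U.run_computable' (Primrec.to_comp (primrec_natString.comp
    (Primrec.fst.comp (Primrec.snd.comp Primrec.fst)) (Primrec.nat_mod.comp Primrec.snd hk)))
    (Computable.const []) (Primrec.to_comp (Primrec.nat_div.comp Primrec.snd hk))) ?_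
  classical
  refine Primrec.to_comp (Primrec.cond ?_ (Primrec.option_some.comp Primrec.snd)
    (Primrec.const none))
  have h1 : Primrec fun q : (((List Bool × List Bool) × (ℕ × ℕ)) × ℕ) × List Bool =>
      ((q.1.1.1.2, q.1.1.2.2), q.2) :=
    Primrec.pair (Primrec.pair
      (Primrec.snd.comp (Primrec.fst.comp (Primrec.fst.comp Primrec.fst)))
      (Primrec.snd.comp (Primrec.snd.comp (Primrec.fst.comp Primrec.fst)))) Primrec.snd
  exact (primrecPred_isModelCode.comp h1).decide.of_eq fun q => by simp

/-- The search of `modelSearch` returns a witness: the order in which programs are tested is the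
order of `IsFirst`. -/
theorem mem_modelSearch {U : Machine} {x p : List Bool} {α l : ℕ} {S : Finset (List Bool)}
    (hl : l = structureFn U x α) (hlS : logCard S ≤ l) (hx : x ∈ S)
    (hp : IsFirst U {q | q.length = α ∧ ∃ S', OutputsOptimal U x α q S'} p)
    (hout : U.Outputs p [] (setCode S)) : setCode S ∈ modelSearch U (code (α, l)) x := by
  simp only [modelSearch, uncode_code, Part.coe_some, Part.bind_some]
  obtain ⟨t, ht⟩ := hout
  obtain ⟨j, hj, hjp⟩ := exists_natString_eq p
  obtain ⟨⟨hpl, -⟩, hfirst⟩ := hp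
  rw [hpl] at hj hjp
  have hpos : 0 < 2 ^ α := by positivity
  have hdiv : (t * 2 ^ α + j) / 2 ^ α = t := by
    rw [mul_comm, Nat.mul_add_div hpos, Nat.div_eq_of_lt hj, add_zero]
  have hmod : (t * 2 ^ α + j) % 2 ^ α = j := by
    rw [mul_comm, Nat.mul_add_mod, Nat.mod_eq_of_lt hj]
  refine mem_rfindOpt_of_first (n := t * 2 ^ α + j) ?_ fun M hM => ?_
  · rw [modelSearchStep_eq_some_iff]
    dsimp only
    rw [hdiv, hmod, hjp]
    exact ⟨ht, S, rfl, hx, hlS⟩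
  · by_contra hne
    obtain ⟨y, hy⟩ := Option.ne_none_iff_exists'.1 hne
    obtain ⟨hrun, S', rfl, hx', hl'⟩ := modelSearchStep_eq_some_iff.1 hy
    dsimp only at hrun hl'
    have h := hfirst (natString α (M % 2 ^ α)) ⟨by simp, S', ⟨_, hrun⟩, hx', hl ▸ hl'⟩
    rw [Machine.rt_eq ht, Machine.rt_eq hrun] at h
    have hM' := Nat.div_add_mod M (2 ^ α)
    have hMj := Nat.mod_lt M hpos
    rcases h with h | ⟨h, hle⟩
    · have : (t + 1) * 2 ^ α ≤ (M / 2 ^ α) * 2 ^ α := Nat.mul_le_mul_right _ h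
      rw [mul_comm] at hM'
      rw [add_one_mul] at this
      omega
    · have hlt : M % 2 ^ α < j := by
        rw [← h, mul_comm] at hM'
        omega
      exact absurd hle (not_le.2 (hjp ▸ natString_lt hlt hj))

/-- A minimal partial model can be computed from `x`, its complexity and its log-cardinality; the
program `x*` may take the place of `x`. -/
theorem condK_minimalPartialModel_le {U : Machine} (hU : U.IsUniversal) :
    ∃ C : ℕ, ∀ (e : List Bool → ℕ → ℕ) (c d : ℕ) (x : List Bool) (S : Finset (List Bool)),
      S ∈ minimalPartialModels U e c d x →
        condK U (setCode S) x ≤ condK U (code (setK U S, logCard S)) x + C ∧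
        condK U (setCode S) (star U x) ≤ condK U (code (setK U S, logCard S)) (star U x) + C := by
  obtain ⟨a, ha⟩ := condK_le_of_transform hU (g := fun y => Part.some y) Computable.id
    (modelSearch_partrec U)
  obtain ⟨b, hb⟩ := condK_le_of_transform hU (g := fun y => Part.some y) Computable.id
    (f := fun w u => (U.eval u []).bind fun x => modelSearch U w x)
    (Partrec.bind (U.eval_partrec.comp Computable.snd (Computable.const []))
      ((modelSearch_partrec U).comp (Computable.fst.comp Computable.fst) Computable.snd).to₂)
  refine ⟨a + b, fun e c d x S hS => ?_⟩
  obtain ⟨⟨p, hp, hout⟩, hx, hl, -⟩ := minimalPartialModels_spec hU hS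
  have h := mem_modelSearch hl le_rfl hx hp hout
  have h1 := ha x x _ _ (Part.mem_some _) h
  have h2 := hb (star U x) (star U x) _ _ (Part.mem_some _)
    (Part.mem_bind ((U.mem_eval _ _ _).2 (star_spec hU x).1) h)
  omega

theorem logCard_eq_length_bits (S : Finset (List Bool)) :
    logCard S = ((S.sort (· ≤ ·)).length - 1).bits.length := by
  rw [Finset.length_sort, Nat.size_eq_bits_len, logCard]
  refine eq_of_forall_ge_iff fun l => ?_
  rw [Nat.clog_le_iff_le_pow one_lt_two, Nat.size_le]
  have : 0 < 2 ^ l := by positivity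
  omega

/-- The log-cardinality can be read off the code of the set. -/
theorem condK_setK_logCard_le {U : Machine} (hU : U.IsUniversal) :
    ∃ c : ℕ, ∀ (S : Finset (List Bool)) (y : List Bool),
      condK U (code (setK U S, logCard S)) y ≤ condK U (code (setK U S, setCode S)) y + c := by
  obtain ⟨c, hc⟩ := condK_map_le hU (f := fun w =>
    ((uncode (ℕ × List Bool) w).map fun a => code (a.1,
      (((uncode (List (List Bool)) a.2).getD []).length - 1).bits.length)).getD []) (by
    refine Primrec.to_comp (Primrec.option_getD.comp (Primrec.option_map primrec_uncode ?_)
      (Primrec.const []))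
    refine primrec_code.comp (Primrec.pair (Primrec.fst.comp Primrec.snd) ?_)
    exact Primrec.list_length.comp (primrec_bits.comp (Primrec.nat_sub.comp
      (Primrec.list_length.comp (Primrec.option_getD.comp
        (primrec_uncode.comp (Primrec.snd.comp Primrec.snd)) (Primrec.const [])))
      (Primrec.const 1))))
  refine ⟨c, fun S y => ?_⟩
  have := hc (code (setK U S, setCode S)) y
  rwa [uncode_code, Option.map_some, Option.getD_some, setCode, uncode_code, Option.getD_some,
    ← logCard_eq_length_bits] at this

/-! ### Logarithmic bounds -/

/-- The set of all strings of length `n`. -/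
def cube (n : ℕ) : Finset (List Bool) :=
  ((List.range (2 ^ n)).map (natString n)).toFinset

theorem mem_cube (x : List Bool) : x ∈ cube x.length := by
  obtain ⟨j, hj, h⟩ := exists_natString_eq x
  simpa [cube] using ⟨j, hj, h⟩

theorem logCard_cube_le (n : ℕ) : logCard (cube n) ≤ n := by
  rw [logCard, Nat.clog_le_iff_le_pow one_lt_two]
  exact (List.toFinset_card_le _).trans (by simp)

theorem setCode_cube (n : ℕ) : setCode (cube n) =
    code ((List.range (2 ^ n)).map (natString n)) := by
  refine setCode_toFinset (List.pairwise_map.2 ?_)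
  refine List.pairwise_lt_range.imp_of_mem fun {a b} _ hb hab => ?_
  exact natString_lt hab (by simpa using hb)

theorem condK_le_two_mul_length {U : Machine} (hU : U.IsUniversal) :
    ∃ c : ℕ, ∀ v y, condK U v y ≤ 2 * v.length + c := by
  obtain ⟨c, hc⟩ := exists_program hU
  refine ⟨c, fun v y => ?_⟩
  obtain ⟨q, hq, hl⟩ := hc y v
  exact (condK_le hq).trans hl

theorem setK_cube_le {U : Machine} (hU : U.IsUniversal) :
    ∃ c : ℕ, ∀ n : ℕ, setK U (cube n) ≤ 2 * n.size + c := by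
  obtain ⟨a, ha⟩ := K_map_le hU (f := fun w => code ((List.range (2 ^ ((uncode ℕ w).getD 0))).map
      (natString ((uncode ℕ w).getD 0)))) (by
    have h : Primrec fun w => (uncode ℕ w).getD 0 :=
      Primrec.option_getD.comp primrec_uncode (Primrec.const 0)
    exact (primrec_code.comp (Primrec.list_map
      (Primrec.list_range.comp (primrec_pow.comp (Primrec.const 2) h))
      (primrec_natString.comp (h.comp Primrec.fst) Primrec.snd).to₂)).to_comp)
  obtain ⟨b, hb⟩ := condK_le_two_mul_length hU
  refine ⟨a + b, fun n => ?_⟩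
  have h1 := ha (code n)
  have h2 := hb (code n) []
  rw [uncode_code, Option.getD_some, ← setCode_cube] at h1
  have h3 : (code n).length = n.size := by
    simp [code, Nat.size_eq_bits_len]
  unfold setK
  unfold K at h1 ⊢
  omega

theorem setK_singleton_le {U : Machine} (hU : U.IsUniversal) :
    ∃ c : ℕ, ∀ x : List Bool, setK U {x} ≤ 2 * x.length + c := by
  obtain ⟨a, ha⟩ := K_map_le hU (f := fun x => code [x])
    (primrec_code.comp (Primrec.list_cons.comp Primrec.id (Primrec.const []))).to_comp
  obtain ⟨b, hb⟩ := condK_le_two_mul_length hU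
  refine ⟨a + b, fun x => ?_⟩
  have h1 := ha x
  have h2 := hb x []
  rw [setK, setCode, Finset.sort_singleton]
  unfold K at h1 ⊢
  omega

theorem length_code_pair_le {k l s : ℕ} (hk : k < 2 ^ s) (hl : l < 2 ^ s) :
    (code (k, l)).length ≤ 2 * s := by
  refine length_code_le ((Nat.pair_lt_max_add_one_sq k l).trans_le ?_)
  rw [mul_comm, pow_mul]
  exact Nat.pow_le_pow_left (Nat.succ_le_of_lt (max_lt hk hl)) 2

/-- The estimates for minimal partial models, with the number of binary digits of `|x|` in place of
its logarithm. -/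
theorem minimalPartialModels_bounds {U : Machine} (hU : U.IsUniversal) :
    ∃ C : ℕ, ∀ (e : List Bool → ℕ → ℕ) (c d : ℕ) (x : List Bool) (S : Finset (List Bool)),
      S ∈ minimalPartialModels U e c d x →
        condK U (setCode S) (star U x) ≤ condK U (code (setK U S, logCard S)) (star U x) + C ∧
        condK U (code (setK U S, logCard S)) (star U x) ≤ condK U (setCode S) (star U x) + C ∧
        condK U (setCode S) x ≤ 10 * x.length.size + C ∧
        condK U (code (setK U S, logCard S)) (star U x) ≤ 10 * x.length.size + C ∧
        K U x ≤ setK U S + condK U x (setCode S) + C ∧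
        setK U S + condK U x (setCode S) ≤ K U x + 20 * x.length.size + C := by
  obtain ⟨c₁, h₁⟩ := condK_minimalPartialModel_le hU
  obtain ⟨c₂, h₂⟩ := condK_setK_logCard_le hU
  obtain ⟨c₃, h₃⟩ := condK_K_pair_le hU
  obtain ⟨c₄, h₄⟩ := K_add_condK_le hU
  obtain ⟨c₅, h₅⟩ := K_le_K_add_condK hU
  obtain ⟨c₆, h₆⟩ := setK_cube_le hU
  obtain ⟨c₇, h₇⟩ := setK_singleton_le hU
  obtain ⟨c₈, h₈⟩ := condK_program_le hU
  obtain ⟨c₉, h₉⟩ := condK_le_K hU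
  obtain ⟨c₀, h₀⟩ := condK_le_two_mul_length hU
  refine ⟨c₁ + 2 * c₂ + 2 * c₃ + c₄ + c₅ + c₆ + 10 * c₇ + 2 * c₈ + c₉ + c₀ + 20,
    fun e c d x S hS => ?_⟩
  obtain ⟨hx₁, hs₁⟩ := h₁ e c d x S hS
  obtain ⟨-, -, -, hpareto⟩ := minimalPartialModels_spec hU hS
  obtain ⟨hstar, hlen⟩ := star_spec hU x
  have e₂ := h₂ S (star U x)
  have e₃ := h₃ x (setCode S) _ hstar hlen
  have e₄ := h₄ x (setCode S) _ hstar hlen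
  have e₅ := h₅ x (setCode S)
  have e₈ := h₈ (setCode S) x _ hstar
  have e₉ := h₉ (setCode S) x
  have e₀ := h₀ (code (setK U S, logCard S)) x
  -- comparison with the model `{x}`, which cannot be larger
  have hk : setK U S ≤ 2 * x.length + c₇ := by
    rcases hpareto {x} (by simp) with h | h
    · exact h.trans (h₇ x)
    · simp [logCard] at h
  have hn : x.length < 2 ^ x.length.size := Nat.lt_size_self _
  have hk' : setK U S < 2 ^ (x.length.size + c₇ + 2) := by
    have hc : c₇ < 2 ^ c₇ := Nat.lt_two_pow_self
    rw [pow_add, pow_add]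
    nlinarith
  have hsize : (setK U S).size ≤ x.length.size + c₇ + 2 := Nat.size_le.2 hk'
  -- comparison with the model of all strings of the same length
  have hcond : condK U (setCode S) x ≤ 4 * x.length.size + (4 * c₇ + 8 + c₀ + c₁ + c₆ + c₉) := by
    rcases hpareto _ (mem_cube x) with h | h
    · have := h₆ x.length
      unfold setK at h this
      omega
    · have hl : logCard S < 2 ^ (x.length.size + c₇ + 2) :=
        (h.trans_le (logCard_cube_le _)).trans (hn.trans_le
          (Nat.pow_le_pow_right two_pos (by omega)))
      have := length_code_pair_le hk' hl
      omega
  unfold setK at *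
  refine ⟨?_, ?_, ?_, ?_, ?_, ?_⟩ <;> omega

theorem size_le_logb {n : ℕ} (hn : 2 ≤ n) : (n.size : ℝ) ≤ 2 * Real.logb 2 n ∧
    1 ≤ Real.logb 2 n := by
  have h1 : (1 : ℝ) ≤ Real.logb 2 n := by
    rw [Real.le_logb_iff_rpow_le one_lt_two (by positivity)]
    simpa using hn
  refine ⟨?_, h1⟩
  have h2 : n.size ≤ Nat.log 2 n + 1 := Nat.size_le.2 (Nat.lt_pow_succ_log_self one_lt_two n)
  have h3 : (n.size : ℝ) ≤ Nat.log 2 n + 1 := by exact_mod_cast h2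
  have h4 : (Nat.log 2 n : ℝ) ≤ Real.logb 2 n := by exact_mod_cast Real.natLog_le_logb n 2
  linarith

end AlgStat

theorem mainTheorem1 (U : AlgStat.Machine) (hU : U.IsUniversal) :
    ∃ C : ℕ, ∀ (e : List Bool → ℕ → ℕ) (c d : ℕ) (x : List Bool) (S : Finset (List Bool)),
      S ∈ AlgStat.minimalPartialModels U e c d x →
        |(AlgStat.condK U (AlgStat.setCode S) (AlgStat.star U x) : ℝ) -
            AlgStat.condK U (AlgStat.code (AlgStat.setK U S, AlgStat.logCard S))
              (AlgStat.star U x)| ≤ C ∧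
        (2 ≤ x.length →
          (AlgStat.condK U (AlgStat.setCode S) x : ℝ) ≤ C * Real.logb 2 x.length ∧
          (AlgStat.condK U (AlgStat.code (AlgStat.setK U S, AlgStat.logCard S))
              (AlgStat.star U x) : ℝ) ≤ C * Real.logb 2 x.length ∧
          |(AlgStat.K U x : ℝ) -
              (AlgStat.setK U S + AlgStat.condK U x (AlgStat.setCode S))| ≤
            C * Real.logb 2 x.length) := by
  obtain ⟨C, hC⟩ := AlgStat.minimalPartialModels_bounds hU
  refine ⟨40 + C, fun e c d x S hS => ?_⟩
  obtain ⟨h1, h2, h3, h4, h5, h6⟩ := hC e c d x S hS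
  -- the length `|x|` has at most `2 log |x|` digits
  rify at h1 h2 h3 h4 h5 h6
  push_cast
  refine ⟨abs_le.2 ⟨by linarith, by linarith⟩, fun hn => ?_⟩
  obtain ⟨hs, hl⟩ := AlgStat.size_le_logb hn
  have hCl : (C : ℝ) ≤ C * Real.logb 2 x.length := le_mul_of_one_le_right (by positivity) hl
  refine ⟨by linarith, by linarith, abs_le.2 ⟨by linarith, by linarith⟩⟩
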